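/- **Definitions.** For $c=(c_1,c_2,c_3)\in\mathbb{R}^3$ let $P_c(x)=c_1(1-x)+c_2(1+x)+c_3(1-x^2)$. For $c_1,c_2\ge 0$ let $c_3^*(c_1,c_2)=-\tfrac12\left(c_1+2\sqrt{c_1c_2}+c_2\right)$, let $J_0=\{c\in\mathbb{R}^3: c_1\ge 0,\ c_2\ge 0,\ c_3\ge c_3^*(c_1,c_2)\}$, and let $\mathring J_0$ be the interior of $J_0$. For $c\in J_0\setminus\{0\}$ put $\alpha(c)=1$ if $c_1,c_2>0$ and $c_3>c_3^*(c_1,c_2)$; $\alpha(c)=\tfrac23$ if $c_3=c_3^*(c_1,c_2)<0$; $\alpha(c)=\tfrac12$ if $c_1c_2=0$ and $c_3>c_3^*(c_1,c_2)$. For $\nu>0$ and $c\in J_0$ consider the equation $$\nu(1-x^2)U'+2\nu xU+\tfrac12U^2=P_c(x),\qquad -1<x<1,\tag{1}$$ for $U\in C^1(-1,1)$. Its upper solution $U^+_\nu(c)$ and lower solution $U^-_\nu(c)$ are its greatest and its least solution on $(-1,1)$. Norms over empty sets are $0$. **Theorem.** Let $c\in\mathbb{R}^3$, $c\neq 0$.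 Let $\nu_k>0$, $\nu_k\to0$, $c_k\in J_0$, $c_k\to c$, and for each $k$ let $U_k\in C^1(-1,1)$ be a solution of (1) with $\nu=\nu_k$ and $c=c_k$, other than $U^\pm_{\nu_k}(c_k)$. Then for every $k$ with $c_k\ne0$ (hence for all large $k$) $U_k$ has at most one zero in $(-1,1)$. If $c_1,c_2>0$, then for all large $k$ the function $U_k$ has a zero in $(-1,1)$. In (i)–(iii), assumptions on $x_k$ and assumptions that $U_k$ has no zero are required for all large $k$. (i) Suppose $x_k\in(-1,1)$ and $U_k(x_k)=0$. Then for every $\epsilon>0$ $$\lim_{k\to\infty}\Big(\|U_k+\sqrt{2P_c}\|_{L^\infty(-1,x_k-\epsilon)}+\|U_k-\sqrt{2P_c}\|_{L^\infty(x_k+\epsilon,1)}\Big)=0,$$ and for every $\epsilon>0$ and $0<\beta<\alpha(c)$ there is a constant $C>0$, depending only on $c,\epsilon,\beta$, such that for all large $k$ $$\big\|\tfrac12U_k^2-P_{c_k}\big\|_{L^\infty((-1,x_k-\epsilon)\cup(x_k+\epsilon,1))}+\nu_k^\beta\big\|\tfrac12U_k^2-P_{c_k}\big\|_{C^\beta((-1+\epsilon,x_k-\epsilon)\cup(x_k+\epsilon,1-\epsilon))}\le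 C\nu_k^{\alpha(c)}.$$ (ii) If $c_1=0$ and there are $x_k\in(-1,1)$ with $U_k(x_k)=0$ and $x_k\to-1$, or if $c_2>0=c_1$ and $U_k\neq0$ on $(-1,1)$, then $$\lim_{k\to\infty}\|U_k-\sqrt{2P_c}\|_{L^\infty(-1,1)}=0.\tag{2}$$ If $c_2=0$ and there are $x_k\in(-1,1)$ with $U_k(x_k)=0$ and $x_k\to1$, or if $c_1>0=c_2$ and $U_k\ne0$ on $(-1,1)$, then $$\lim_{k\to\infty}\|U_k+\sqrt{2P_c}\|_{L^\infty(-1,1)}=0.\tag{3}$$ If $c_1=c_2=0$ and $U_k\ne0$ on $(-1,1)$, then, after passing to a subsequence, (2) or (3) holds. (iii) If $c\in\mathring J_0$, then for all large $k$ the function $U_k$ has a zero in $(-1,1)$. Moreover, for every $\epsilon>0$ and every positive integer $m$ there is a constant $C>0$, depending only on $\epsilon,m,c$, such that if $x_k\in(-1,1)$ and $U_k(x_k)=0$, then for all large $k$ $$\|U_k+\sqrt{2P_{c_k}}\|_{L^\infty(-1,x_k-\epsilon)}+\|U_k-\sqrt{2P_{c_k}}\|_{L^\infty(x_k+\epsilon,1)}\le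 C\nu_k,$$ $$\|U_k+\sqrt{2P_{c_k}}\|_{C^m(-1+\epsilon,x_k-\epsilon)}+\|U_k-\sqrt{2P_{c_k}}\|_{C^m(x_k+\epsilon,1-\epsilon)}\le C\nu_k.$$ -/

import Mathlib

open Set Filter Topology MeasureTheory
open scoped ENNReal NNReal

noncomputable section

namespace ReducedNS

/-- The second order polynomial `P_c(x) = c₁(1-x) + c₂(1+x) + c₃(1-x²)`, where a parameter
`c = (c₁, c₂, c₃)` has the components `c.1`, `c.2.1` and `c.2.2`. -/
def P (c : ℝ × ℝ × ℝ) (x : ℝ) : ℝ :=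
  c.1 * (1 - x) + c.2.1 * (1 + x) + c.2.2 * (1 - x ^ 2)

/-- `c₃*(c₁, c₂) = -(c₁ + 2√(c₁c₂) + c₂)/2`. -/
def c3star (c₁ c₂ : ℝ) : ℝ := -(1 / 2) * (c₁ + 2 * √(c₁ * c₂) + c₂)

/-- The closed parameter set `J₀ = {c | c₁ ≥ 0, c₂ ≥ 0, c₃ ≥ c₃*(c₁, c₂)}`. -/
def J0 : Set (ℝ × ℝ × ℝ) :=
  {c | 0 ≤ c.1 ∧ 0 ≤ c.2.1 ∧ c3star c.1 c.2.1 ≤ c.2.2}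

/-- The exponent `α(c)` for `c ∈ J₀ \ {0}`: it is `1` if `c₁, c₂ > 0` and `c₃ > c₃*`, it is `2/3` if
`c₃ = c₃* < 0`, and `1/2` in the remaining case `c₁c₂ = 0`, `c₃ > c₃*`. -/
def alpha (c : ℝ × ℝ × ℝ) : ℝ :=
  if 0 < c.1 ∧ 0 < c.2.1 ∧ c3star c.1 c.2.1 < c.2.2 then 1
  else if c.2.2 = c3star c.1 c.2.1 ∧ c.2.2 < 0 then 2 / 3
  else 1 / 2

/-- `U ∈ C¹(-1, 1)` solves `ν(1-x²)U' + 2νxU + U²/2 = P_c` in `(-1, 1)`. Values of `U` outside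
`(-1, 1)` play no role. -/
def IsSolution (ν : ℝ) (c : ℝ × ℝ × ℝ) (U : ℝ → ℝ) : Prop :=
  ContDiffOn ℝ 1 U (Ioo (-1) 1) ∧
    ∀ x ∈ Ioo (-1 : ℝ) 1,
      ν * (1 - x ^ 2) * deriv U x + 2 * ν * x * U x + U x ^ 2 / 2 = P c x

/-- `U` is the upper solution `U⁺` on `(-1, 1)`, that is, the greatest solution. -/
def IsUpperSolution (ν : ℝ) (c : ℝ × ℝ × ℝ) (U : ℝ → ℝ) : Prop :=
  IsSolution ν c U ∧ ∀ V, IsSolution ν c V → ∀ x ∈ Ioo (-1 : ℝ) 1, V x ≤ U x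

/-- `U` is the lower solution `U⁻` on `(-1, 1)`, that is, the least solution. -/
def IsLowerSolution (ν : ℝ) (c : ℝ × ℝ × ℝ) (U : ℝ → ℝ) : Prop :=
  IsSolution ν c U ∧ ∀ V, IsSolution ν c V → ∀ x ∈ Ioo (-1 : ℝ) 1, U x ≤ V x

/-- The sequences under consideration: `νₖ → 0⁺`, `cₖ ∈ J₀`, `cₖ → c`, and `Uₖ` is a solution with
parameters `νₖ`, `cₖ` other than the upper and the lower solution. -/
structure IsViscositySequence (c : ℝ × ℝ × ℝ) (ν : ℕ → ℝ) (cs : ℕ → ℝ × ℝ × ℝ)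
    (U : ℕ → ℝ → ℝ) : Prop where
  nu_pos : ∀ k, 0 < ν k
  nu_tendsto : Tendsto ν atTop (𝓝 0)
  c_mem : ∀ k, cs k ∈ J0
  c_tendsto : Tendsto cs atTop (𝓝 c)
  solution : ∀ k, IsSolution (ν k) (cs k) (U k)
  not_upper : ∀ k, ¬ IsUpperSolution (ν k) (cs k) (U k)
  not_lower : ∀ k, ¬ IsLowerSolution (ν k) (cs k) (U k)

/-- For all large `k` the point `x k` is a zero of `U k` in `(-1, 1)`. -/
def IsZeroSequence (U : ℕ → ℝ → ℝ) (x : ℕ → ℝ) : Prop :=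
  ∀ᶠ k in atTop, x k ∈ Ioo (-1 : ℝ) 1 ∧ U k (x k) = 0

/-- For all large `k` the function `U k` has no zero in `(-1, 1)`. -/
def IsZeroFree (U : ℕ → ℝ → ℝ) : Prop :=
  ∀ᶠ k in atTop, ∀ x ∈ Ioo (-1 : ℝ) 1, U k x ≠ 0

/-- The norm of `L^∞(s)` for Lebesgue measure on `s` (it is `0` for empty `s`). -/
def linftyNorm (s : Set ℝ) (f : ℝ → ℝ) : ℝ≥0∞ := eLpNorm f ∞ (volume.restrict s)

/-- The Hölder norm of `C^β(s)`, `sup_s |f| + sup_{x ≠ y} |f x - f y| / |x - y|^β`. -/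
def holderNorm (β : ℝ≥0) (s : Set ℝ) (f : ℝ → ℝ) : ℝ≥0∞ :=
  (⨆ x ∈ s, ‖f x‖ₑ) + eHolderNorm β (fun x : s => f x)

open scoped Classical in
/-- The norm of `C^m(s)` for open `s`: `∑_{j ≤ m} sup_s |f^(j)|`, and `∞` if `f` is not `C^m`
on `s`. -/
def cmNorm (m : ℕ) (s : Set ℝ) (f : ℝ → ℝ) : ℝ≥0∞ :=
  if ContDiffOn ℝ m f s then
    ∑ j ∈ Finset.range (m + 1), ⨆ x ∈ s, ‖iteratedDeriv j f x‖ₑ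
  else ∞

end ReducedNS

end

noncomputable section

namespace ReducedNS

/-! Write `U = 2ν(1-x²)φ'/φ` with `φ > 0`. The equation becomes `2ν²(1-x²)²φ'' = P_c φ`, and `P_c ≥
0` makes `φ'` monotone, so `U` can change sign only once, from negative to positive
(`IsSolution.pos_of_zero`). If `c₁ > 0`, a positive solution has `φ → 0` at `-1`, and constancy of
the Wronskian then excludes any solution that is larger somewhere: it is the upper solution
(`IsSolution.isUpperSolution_of_pos`). The reflection `x ↦ -U(-x)` exchanges upper and lower
solutions. Hence for `c₁, c₂ > 0` every other solution has a zero, and in general only the region to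
the right of the zero, where `U > 0`, has to be studied.

There the error `E = U²/2 - P_c` solves the linear equation `ν(1-x²)E' = -U E + O(ν)`, with `U`
bounded by a barrier (`IsSolution.le_of_barrier`). The damping suggests `E = O(ν/U)`. In general `U`
may be small, and the balance `U ~ ν^(1/3)` gives `E = O(ν^(2/3))` (`IsSolution.abs_error_le`). If
`P_c > 0` on `[-1, 1]`, this first bound keeps `U` away from `0`, and a second pass gives `O(ν)`
(`IsSolution.abs_error_le_linear`). Away from the end points the equation bounds `E'` by
`O(ν^(α-1))`, and interpolation yields the Hölder estimate.

For `P_c > 0` the scaled difference `(U - √(2P_c))/ν` again solves a damped linear equation.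
Differentiating it repeatedly bounds all its derivatives (`CB.of_linear`, `CB.scaled_sub_profile`).
If `c₁ = 0`, then `P_c(-1) = 0`, so barriers keep `U` small near `-1` and the convergence extends to
that end point.

All estimates are stated eventually along the filter `admFilter c`. The constants are thus fixed
before any sequence is chosen, and sequences enter only through a `Tendsto` into this filter. -/

/-! ### The polynomial `P_c` -/

/-- The derivative of `P_c`. -/
def dP (c : ℝ × ℝ × ℝ) (x : ℝ) : ℝ := -c.1 + c.2.1 - 2 * c.2.2 * x

/-- A bound for `|P_c|` and `|P_c'|` on `[-1, 1]`. -/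
def bound (c : ℝ × ℝ × ℝ) : ℝ := 2 * (|c.1| + |c.2.1| + |c.2.2|)

lemma hasDerivAt_P (c : ℝ × ℝ × ℝ) (x : ℝ) : HasDerivAt (P c) (dP c x) x := by
  unfold P dP
  have h := (((hasDerivAt_id' x).const_sub 1).const_mul c.1).add
    (((hasDerivAt_id' x).const_add 1).const_mul c.2.1) |>.add
    (((hasDerivAt_pow 2 x).const_sub 1).const_mul c.2.2)
  refine h.congr_deriv ?_
  norm_num
  ring

lemma continuous_P (c : ℝ × ℝ × ℝ) : Continuous (P c) := by
  unfold P; fun_prop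

lemma continuous_bound : Continuous bound := by unfold bound; fun_prop

lemma abs_P_le (c : ℝ × ℝ × ℝ) {x : ℝ} (hx : x ∈ Icc (-1 : ℝ) 1) : |P c x| ≤ bound c := by
  obtain ⟨h1, h2⟩ := hx
  unfold P bound
  have e1 : |c.1 * (1 - x)| ≤ |c.1| * 2 := by
    rw [abs_mul]; gcongr; rw [abs_le]; constructor <;> linarith
  have e2 : |c.2.1 * (1 + x)| ≤ |c.2.1| * 2 := by
    rw [abs_mul]; gcongr; rw [abs_le]; constructor <;> linarith
  have e3 : |c.2.2 * (1 - x ^ 2)| ≤ |c.2.2| * 2 := by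
    rw [abs_mul]; gcongr; rw [abs_le]; constructor <;> nlinarith
  have := abs_add_three (c.1 * (1 - x)) (c.2.1 * (1 + x)) (c.2.2 * (1 - x ^ 2))
  linarith

lemma abs_dP_le (c : ℝ × ℝ × ℝ) {x : ℝ} (hx : x ∈ Icc (-1 : ℝ) 1) : |dP c x| ≤ bound c := by
  obtain ⟨h1, h2⟩ := hx
  unfold dP bound
  have e3 : |2 * c.2.2 * x| ≤ 2 * |c.2.2| * 1 := by
    rw [abs_mul, abs_mul, abs_two]; gcongr; rw [abs_le]; constructor <;> linarith
  have := abs_sub (-c.1 + c.2.1) (2 * c.2.2 * x)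
  have := abs_add_le (-c.1) c.2.1
  rw [abs_neg] at this
  linarith [abs_nonneg c.1, abs_nonneg c.2.1]

/-- Completing the square explains `c3star`: it is the value of `c₃` at which `P_c` is half a
perfect square. -/
lemma P_eq {c : ℝ × ℝ × ℝ} (h1 : 0 ≤ c.1) (h2 : 0 ≤ c.2.1) (x : ℝ) :
    P c x = (√c.1 * (1 - x) - √c.2.1 * (1 + x)) ^ 2 / 2 +
      (c.2.2 - c3star c.1 c.2.1) * (1 - x ^ 2) := by
  unfold P c3star
  rw [Real.sqrt_mul h1]
  have e1 := Real.sq_sqrt h1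
  have e2 := Real.sq_sqrt h2
  linear_combination (-(1 - x) ^ 2 / 2) * e1 - ((1 + x) ^ 2 / 2) * e2

lemma P_nonneg {c : ℝ × ℝ × ℝ} (hc : c ∈ J0) {x : ℝ} (hx : x ∈ Icc (-1 : ℝ) 1) : 0 ≤ P c x := by
  obtain ⟨h1, h2, h3⟩ := hc
  rw [P_eq h1 h2]
  have : 0 ≤ (c.2.2 - c3star c.1 c.2.1) * (1 - x ^ 2) :=
    mul_nonneg (sub_nonneg.2 h3) (by nlinarith [hx.1, hx.2])
  positivity

lemma P_pos {c : ℝ × ℝ × ℝ} (h1 : 0 < c.1) (h2 : 0 < c.2.1) (h3 : c3star c.1 c.2.1 < c.2.2)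
    {x : ℝ} (hx : x ∈ Icc (-1 : ℝ) 1) : 0 < P c x := by
  rcases eq_or_lt_of_le hx.1 with h | h
  · subst h; unfold P; nlinarith
  rcases eq_or_lt_of_le hx.2 with h' | h'
  · subst h'; unfold P; nlinarith
  rw [P_eq h1.le h2.le]
  have : 0 < (c.2.2 - c3star c.1 c.2.1) * (1 - x ^ 2) :=
    mul_pos (sub_pos.2 h3) (by nlinarith)
  positivity

lemma eq_zero_of_P_eq_zero {c : ℝ × ℝ × ℝ} {a b : ℝ} (hab : a < b)
    (h : ∀ x ∈ Ioo a b, P c x = 0) : c = 0 := by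
  have h1 : ∀ x ∈ Ioo a b, dP c x = 0 := fun x hx => by
    have e : P c =ᶠ[𝓝 x] fun _ => 0 :=
      Filter.eventuallyEq_of_mem (Ioo_mem_nhds hx.1 hx.2) (fun y hy => h y hy)
    exact ((hasDerivAt_P c x).congr_of_eventuallyEq e.symm).unique (hasDerivAt_const x 0)
  have p1 : (2 * a + b) / 3 ∈ Ioo a b := by constructor <;> linarith
  have p2 : (a + 2 * b) / 3 ∈ Ioo a b := by constructor <;> linarith
  have e1 := h1 _ p1
  have e2 := h1 _ p2
  have e3 := h _ p1
  unfold dP at e1 e2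
  have h3 : c.2.2 = 0 := by
    have : c.2.2 * (b - a) = 0 := by linarith
    rcases mul_eq_zero.1 this with h | h
    · exact h
    · linarith
  unfold P at e3
  rw [h3] at e1 e3
  have h2 : c.2.1 = c.1 := by linarith
  rw [h2] at e3
  have h4 : c.1 = 0 := by linarith
  ext <;> simp [h3, h4, h2]

/-! ### Reflection -/

/-- The parameter of the reflected equation. -/
def refl (c : ℝ × ℝ × ℝ) : ℝ × ℝ × ℝ := (c.2.1, c.1, c.2.2)

/-- The reflection `x ↦ -U(-x)` of a solution. -/
def reflFun (U : ℝ → ℝ) (x : ℝ) : ℝ := -U (-x)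

@[simp] lemma refl_refl (c : ℝ × ℝ × ℝ) : refl (refl c) = c := rfl

@[simp] lemma reflFun_reflFun (U : ℝ → ℝ) : reflFun (reflFun U) = U := by
  ext x; simp [reflFun]

lemma continuous_refl : Continuous refl := by unfold refl; fun_prop

lemma c3star_comm (a b : ℝ) : c3star a b = c3star b a := by
  unfold c3star; rw [mul_comm a b]; ring

lemma refl_mem_J0 {c : ℝ × ℝ × ℝ} (h : c ∈ J0) : refl c ∈ J0 :=
  ⟨h.2.1, h.1, by rw [c3star_comm]; exact h.2.2⟩

lemma refl_ne_zero {c : ℝ × ℝ × ℝ} (h : c ≠ 0) : refl c ≠ 0 := by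
  intro h'
  apply h
  exact congrArg refl h'

lemma P_refl (c : ℝ × ℝ × ℝ) (x : ℝ) : P (refl c) x = P c (-x) := by
  simp [P, refl]; ring

lemma alpha_refl (c : ℝ × ℝ × ℝ) : alpha (refl c) = alpha c := by
  simp only [alpha, refl, c3star_comm c.2.1 c.1]
  congr 1
  exact propext ⟨fun h => ⟨h.2.1, h.1, h.2.2⟩, fun h => ⟨h.2.1, h.1, h.2.2⟩⟩

lemma neg_mem_Ioo_one {x : ℝ} (hx : x ∈ Ioo (-1 : ℝ) 1) : -x ∈ Ioo (-1 : ℝ) 1 :=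
  ⟨by linarith [hx.2], by linarith [hx.1]⟩

lemma IsSolution.reflect {ν : ℝ} {c : ℝ × ℝ × ℝ} {U : ℝ → ℝ} (h : IsSolution ν c U) :
    IsSolution ν (refl c) (reflFun U) := by
  refine ⟨?_, fun x hx => ?_⟩
  · exact (h.1.comp contDiff_neg.contDiffOn (fun x hx => neg_mem_Ioo_one hx)).neg
  · have hd : deriv (reflFun U) x = deriv U (-x) := by
      unfold reflFun
      rw [deriv.fun_neg, deriv_comp_neg]; simp
    have := h.2 (-x) (neg_mem_Ioo_one hx)
    rw [hd, P_refl]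
    simp only [reflFun]
    linear_combination this

lemma IsUpperSolution.reflect {ν : ℝ} {c : ℝ × ℝ × ℝ} {U : ℝ → ℝ} (h : IsUpperSolution ν c U) :
    IsLowerSolution ν (refl c) (reflFun U) := by
  refine ⟨h.1.reflect, fun V hV x hx => ?_⟩
  have := h.2 _ hV.reflect (-x) (neg_mem_Ioo_one hx)
  simp only [reflFun, neg_neg] at this ⊢
  linarith

lemma IsLowerSolution.reflect {ν : ℝ} {c : ℝ × ℝ × ℝ} {U : ℝ → ℝ} (h : IsLowerSolution ν c U) :
    IsUpperSolution ν (refl c) (reflFun U) := by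
  refine ⟨h.1.reflect, fun V hV x hx => ?_⟩
  have := h.2 _ hV.reflect (-x) (neg_mem_Ioo_one hx)
  simp only [reflFun, neg_neg] at this ⊢
  linarith

lemma IsViscositySequence.reflect {c : ℝ × ℝ × ℝ} {ν : ℕ → ℝ} {cs : ℕ → ℝ × ℝ × ℝ}
    {U : ℕ → ℝ → ℝ} (h : IsViscositySequence c ν cs U) :
    IsViscositySequence (refl c) ν (fun k => refl (cs k)) (fun k => reflFun (U k)) where
  nu_pos := h.nu_pos
  nu_tendsto := h.nu_tendsto
  c_mem k := refl_mem_J0 (h.c_mem k)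
  c_tendsto := (continuous_refl.tendsto c).comp h.c_tendsto
  solution k := (h.solution k).reflect
  not_upper k hk := h.not_lower k (by simpa using hk.reflect)
  not_lower k hk := h.not_upper k (by simpa using hk.reflect)

lemma IsZeroSequence.reflect {U : ℕ → ℝ → ℝ} {x : ℕ → ℝ} (h : IsZeroSequence U x) :
    IsZeroSequence (fun k => reflFun (U k)) (fun k => -x k) := by
  filter_upwards [h] with k hk
  exact ⟨neg_mem_Ioo_one hk.1, by simp [reflFun, hk.2]⟩

lemma IsZeroFree.reflect {U : ℕ → ℝ → ℝ} (h : IsZeroFree U) :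
    IsZeroFree (fun k => reflFun (U k)) := by
  filter_upwards [h] with k hk x hx
  simpa [reflFun] using hk (-x) (neg_mem_Ioo_one hx)

/-! ### Barriers -/

/-- Comparison with the line of slope `-k` that reaches the level `m` at `b`: at a contact point `f
≥ m`, so `f` falls strictly faster than the line. The start may thus exceed `m` by `k` times the
length of the interval. -/
lemma le_of_decay {f f' : ℝ → ℝ} {a b m k : ℝ} (hab : a ≤ b) (hk : 0 ≤ k)
    (hf : ∀ x ∈ Icc a b, HasDerivAt f (f' x) x) (ha : f a ≤ m + k * (b - a))
    (hd : ∀ x ∈ Icc a b, m ≤ f x → f' x < -k) : f b ≤ m := by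
  have := image_le_of_deriv_right_lt_deriv_boundary' (f := f) (f' := f') (a := a) (b := b)
    (B := fun x => m + k * (b - x)) (B' := fun _ => -k)
    (fun x hx => (hf x hx).continuousAt.continuousWithinAt)
    (fun x hx => (hf x (Ico_subset_Icc_self hx)).hasDerivWithinAt) ha (by fun_prop)
    (fun x _ => by
      have := (((hasDerivAt_id' x).const_sub b).const_mul k).const_add m
      simpa using this.hasDerivWithinAt)
    (fun x hx h => hd x (Ico_subset_Icc_self hx) (by
      rw [h]; have := mul_nonneg hk (sub_nonneg.2 hx.2.le); linarith))
    (right_mem_Icc.2 hab)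
  simpa using this

lemma IsSolution.hasDerivAt {ν : ℝ} {c : ℝ × ℝ × ℝ} {U : ℝ → ℝ} (h : IsSolution ν c U)
    (hν : 0 < ν) {x : ℝ} (hx : x ∈ Ioo (-1 : ℝ) 1) :
    HasDerivAt U ((P c x - U x ^ 2 / 2 - 2 * ν * x * U x) / (ν * (1 - x ^ 2))) x := by
  have hd : DifferentiableAt ℝ U x :=
    (h.1.differentiableOn (by norm_num)).differentiableAt (isOpen_Ioo.mem_nhds hx)
  have ha : 0 < 1 - x ^ 2 := by nlinarith [hx.1, hx.2]
  refine hd.hasDerivAt.congr_deriv ?_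
  rw [eq_div_iff (by positivity), ← h.2 x hx]
  ring

/-- Above the level `M` the quadratic term wins: `P ≤ U²/8` and `|2νxU| ≤ U²/4`, which leaves at
least `U²/8` out of `U²/2`. -/
lemma IsSolution.deriv_neg {ν : ℝ} {c : ℝ × ℝ × ℝ} {U : ℝ → ℝ} (hν : 0 < ν) {x M : ℝ}
    (hx : x ∈ Ioo (-1 : ℝ) 1) (hM : 8 * ν ≤ M) (hP : 8 * P c x ≤ M ^ 2) (hU : M ≤ U x) :
    (P c x - U x ^ 2 / 2 - 2 * ν * x * U x) / (ν * (1 - x ^ 2)) ≤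
      -(U x ^ 2 / (8 * ν) * (1 - x ^ 2)⁻¹) := by
  have ha : 0 < 1 - x ^ 2 := by nlinarith [hx.1, hx.2]
  have hU0 : 0 < U x := by linarith
  have e : -(U x ^ 2 / (8 * ν) * (1 - x ^ 2)⁻¹) = (-(U x ^ 2 / 8)) / (ν * (1 - x ^ 2)) := by
    field_simp
  rw [e]
  gcongr
  have h1 : M ^ 2 ≤ U x ^ 2 := by gcongr; linarith
  have h2 : -(2 * ν * x * U x) ≤ 2 * ν * U x := by
    have := mul_le_mul_of_nonneg_left (show -x ≤ 1 by linarith [hx.1])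
      (show 0 ≤ 2 * ν * U x by positivity)
    linarith
  have h3 : 8 * ν * U x ≤ U x * U x := by gcongr; linarith
  nlinarith

/-- A solution starting below the barrier `M` stays below it. -/
lemma IsSolution.le_of_left_le {ν : ℝ} {c : ℝ × ℝ × ℝ} {U : ℝ → ℝ} (h : IsSolution ν c U)
    (hν : 0 < ν) {a b M : ℝ} (ha : -1 < a) (hab : a ≤ b) (hb : b < 1) (hM : 8 * ν ≤ M)
    (hP : ∀ x ∈ Icc a b, 8 * P c x ≤ M ^ 2) (hUa : U a ≤ M) : U b ≤ M := by
  have hs : ∀ x ∈ Icc a b, x ∈ Ioo (-1 : ℝ) 1 := fun x hx =>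
    ⟨ha.trans_le hx.1, hx.2.trans_lt hb⟩
  refine le_of_decay hab le_rfl (fun x hx => h.hasDerivAt hν (hs x hx)) (by simpa using hUa) ?_
  intro x hx hMx
  refine (IsSolution.deriv_neg hν (hs x hx) hM (hP x hx) hMx).trans_lt ?_
  have h1 : 0 < 1 - x ^ 2 := by nlinarith [(hs x hx).1, (hs x hx).2]
  have : 0 < U x := by linarith
  rw [neg_zero, neg_lt_zero]
  positivity

/-- Solutions on `(-1, 1)` cannot come down from infinity at `-1` to a level above the barrier. -/
lemma IsSolution.le_of_barrier {ν : ℝ} {c : ℝ × ℝ × ℝ} {U : ℝ → ℝ} (h : IsSolution ν c U)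
    (hν : 0 < ν) {b M : ℝ} (hb : b ∈ Ioo (-1 : ℝ) 1) (hM : 8 * ν ≤ M)
    (hP : ∀ x ∈ Ioc (-1) b, 8 * P c x ≤ M ^ 2) : U b ≤ M := by
  by_contra! hlt
  have hgt : ∀ x ∈ Ioc (-1) b, M < U x := fun x hx => by
    by_contra! hle
    exact hlt.not_ge (h.le_of_left_le hν hx.1 hx.2 hb.2 hM
      (fun y hy => hP y ⟨hx.1.trans_le hy.1, hy.2⟩) hle)
  have hs : ∀ x ∈ Ioc (-1) b, x ∈ Ioo (-1 : ℝ) 1 := fun x hx => ⟨hx.1, hx.2.trans_lt hb.2⟩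
  -- While `U > M`, the Riccati inequality reads `(1/U)' ≥ 1/(8ν(1-x²)) ≥ 1/(16ν(1+x))`. Integrating
  -- down to `-1`, the logarithm diverges, which would force `1/U` to become negative.
  have key : ∀ a ∈ Ioc (-1) b, (U a)⁻¹ - Real.log (1 + a) / (16 * ν) ≤
      (U b)⁻¹ - Real.log (1 + b) / (16 * ν) := by
    intro a ha
    have hsub : ∀ x ∈ Icc a b, x ∈ Ioc (-1) b := fun x hx => ⟨ha.1.trans_le hx.1, hx.2⟩
    have hd : ∀ x ∈ Icc a b, HasDerivAt (fun x => (U x)⁻¹ - Real.log (1 + x) / (16 * ν))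
        (-((P c x - U x ^ 2 / 2 - 2 * ν * x * U x) / (ν * (1 - x ^ 2))) / U x ^ 2 -
          1 / (1 + x) / (16 * ν)) x := fun x hx => by
      have hx' := hsub x hx
      have hU : 0 < U x := by linarith [hgt x hx']
      exact ((h.hasDerivAt hν (hs x hx')).fun_inv hU.ne').sub
        ((((hasDerivAt_id' x).const_add 1).log (by linarith [hx'.1])).div_const _)
    refine monotoneOn_of_deriv_nonneg (convex_Icc a b)
      (fun x hx => (hd x hx).continuousAt.continuousWithinAt)
      (fun x hx => (hd x (interior_subset hx)).differentiableAt.differentiableWithinAt)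
      (fun x hx => ?_) (left_mem_Icc.2 ha.2) (right_mem_Icc.2 ha.2) ha.2
    have hx0 := interior_subset hx
    have hx' := hsub x hx0
    have hx1 := hs x hx'
    rw [(hd x hx0).deriv]
    have hU : 0 < U x := by linarith [hgt x hx']
    have h0 := IsSolution.deriv_neg hν hx1 hM (hP x hx') (hgt x hx').le
    have h1 : 0 < 1 + x := by linarith [hx1.1]
    have h2 : 0 < 1 - x := by linarith [hx1.2]
    have e : (1 - x ^ 2)⁻¹ = (1 + x)⁻¹ * (1 - x)⁻¹ := by rw [← mul_inv]; ring_nf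
    rw [e] at h0
    have h3 : U x ^ 2 / (8 * ν) * ((1 + x)⁻¹ * (1 - x)⁻¹) / U x ^ 2 ≤
        -((P c x - U x ^ 2 / 2 - 2 * ν * x * U x) / (ν * (1 - x ^ 2))) / U x ^ 2 := by
      gcongr; linarith
    have h4 : U x ^ 2 / (8 * ν) * ((1 + x)⁻¹ * (1 - x)⁻¹) / U x ^ 2 =
        1 / (1 + x) / (16 * ν) * (2 * (1 - x)⁻¹) := by field_simp; norm_num
    have h5 : 1 ≤ 2 * (1 - x)⁻¹ := by
      rw [← div_eq_mul_inv, le_div_iff₀ h2]; linarith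
    have h6 : 0 < 1 / (1 + x) / (16 * ν) := by positivity
    nlinarith
  have hlim : Tendsto (fun a : ℝ => -Real.log (1 + a) / (16 * ν)) (𝓝[>] (-1)) atTop := by
    refine Tendsto.atTop_div_const (by positivity) (tendsto_neg_atBot_atTop.comp ?_)
    refine Real.tendsto_log_nhdsGT_zero.comp ?_
    refine tendsto_nhdsWithin_iff.2 ⟨?_, ?_⟩
    · have : Tendsto (fun a : ℝ => 1 + a) (𝓝 (-1)) (𝓝 (1 + -1)) := by
        apply Continuous.tendsto; fun_prop
      rw [add_neg_cancel] at this
      exact this.mono_left nhdsWithin_le_nhds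
    · filter_upwards [self_mem_nhdsWithin] with a ha
      have : -1 < a := ha
      show 0 < 1 + a
      linarith
  obtain ⟨a, ha1, ha2⟩ := ((hlim.eventually_gt_atTop
    ((U b)⁻¹ - Real.log (1 + b) / (16 * ν))).and (Ioc_mem_nhdsGT hb.1)).exists
  have h1 := key a ha2
  have h2 : 0 < (U a)⁻¹ := inv_pos.2 (by linarith [hgt a ha2])
  rw [neg_div] at ha1
  linarith

/-! ### Linearization of the Riccati equation -/

lemma one_sub_sq_pos {x : ℝ} (hx : x ∈ Ioo (-1 : ℝ) 1) : 0 < 1 - x ^ 2 := by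
  nlinarith [hx.1, hx.2]

/-- The substitution `U = 2ν(1-x²)φ'/φ` turns the equation into `2ν²(1-x²)²φ'' = P_c φ`. -/
lemma IsSolution.exists_linearization {ν : ℝ} {c : ℝ × ℝ × ℝ} {U : ℝ → ℝ} (h : IsSolution ν c U)
    (hν : 0 < ν) : ∃ φ ψ : ℝ → ℝ, (∀ x ∈ Ioo (-1 : ℝ) 1, 0 < φ x) ∧
      (∀ x ∈ Ioo (-1 : ℝ) 1, HasDerivAt φ (ψ x) x) ∧
      (∀ x ∈ Ioo (-1 : ℝ) 1, ψ x = φ x * (U x / (2 * ν * (1 - x ^ 2)))) ∧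
      ∀ x ∈ Ioo (-1 : ℝ) 1,
        HasDerivAt ψ (φ x * (P c x / (2 * ν ^ 2 * (1 - x ^ 2) ^ 2))) x := by
  -- `w` is to be the logarithmic derivative `φ'/φ`, so `φ` is the exponential of its primitive.
  set w : ℝ → ℝ := fun x => U x / (2 * ν * (1 - x ^ 2)) with hw
  have hwd : ∀ x ∈ Ioo (-1 : ℝ) 1,
      HasDerivAt w (P c x / (2 * ν ^ 2 * (1 - x ^ 2) ^ 2) - w x ^ 2) x := fun x hx => by
    have ha := one_sub_sq_pos hx
    have h1 := (h.hasDerivAt hν hx).div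
      (((hasDerivAt_pow 2 x).const_sub 1).const_mul (2 * ν)) (by positivity)
    refine h1.congr_deriv ?_
    simp only [hw]
    field_simp
    push_cast
    ring
  have hwc : ContinuousOn w (Ioo (-1) 1) := fun x hx =>
    (hwd x hx).continuousAt.continuousWithinAt
  have hF : ∀ x ∈ Ioo (-1 : ℝ) 1, HasDerivAt (fun x => ∫ t in (0 : ℝ)..x, w t) (w x) x := by
    intro x hx
    refine intervalIntegral.integral_hasDerivAt_right ?_ ?_ (hwd x hx).continuousAt
    · refine (hwc.mono ?_).intervalIntegrable
      exact (convex_Ioo (-1 : ℝ) 1).ordConnected.uIcc_subset (by norm_num) hx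
    · exact hwc.stronglyMeasurableAtFilter isOpen_Ioo x hx
  refine ⟨fun x => Real.exp (∫ t in (0 : ℝ)..x, w t),
    fun x => Real.exp (∫ t in (0 : ℝ)..x, w t) * w x, fun x _ => Real.exp_pos _,
    fun x hx => (hF x hx).exp, fun x _ => rfl, fun x hx => ?_⟩
  refine ((hF x hx).exp.mul (hwd x hx)).congr_deriv ?_
  ring

lemma monotoneOn_of_hasDerivAt_nonneg {f f' : ℝ → ℝ} {a b : ℝ}
    (hf : ∀ x ∈ Ioo a b, HasDerivAt f (f' x) x) (h0 : ∀ x ∈ Ioo a b, 0 ≤ f' x) :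
    MonotoneOn f (Ioo a b) := by
  refine monotoneOn_of_deriv_nonneg (convex_Ioo a b)
      (fun x hx => (hf x hx).continuousAt.continuousWithinAt)
      (fun x hx => (hf x (interior_subset hx)).differentiableAt.differentiableWithinAt)
      (fun x hx => ?_)
  rw [(hf x (interior_subset hx)).deriv]
  exact h0 x (interior_subset hx)

/-- A solution with `c ∈ J₀ \ {0}` vanishes at most once, and it is positive to the right of its
zero. -/
lemma IsSolution.pos_of_zero {ν : ℝ} {c : ℝ × ℝ × ℝ} {U : ℝ → ℝ} (h : IsSolution ν c U)
    (hν : 0 < ν) (hc : c ∈ J0) (hc0 : c ≠ 0) {x y : ℝ} (hx : x ∈ Ioo (-1 : ℝ) 1)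
    (hUx : U x = 0) (hxy : x < y) (hy : y < 1) : 0 < U y := by
  obtain ⟨φ, ψ, hφ, hφd, hψ, hψd⟩ := h.exists_linearization hν
  have hy' : y ∈ Ioo (-1 : ℝ) 1 := ⟨hx.1.trans hxy, hy⟩
  have hmono : MonotoneOn ψ (Ioo (-1) 1) := monotoneOn_of_hasDerivAt_nonneg hψd (fun z hz =>
    mul_nonneg (hφ z hz).le (div_nonneg (P_nonneg hc (Ioo_subset_Icc_self hz)) (by positivity)))
  have hψx : ψ x = 0 := by rw [hψ x hx, hUx]; simp
  -- Otherwise the monotone `ψ` vanishes on all of `[x, y]`; then so does `P_c` on the open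
  -- interval, which forces `c = 0`.
  have hψy : 0 < ψ y := by
    by_contra! hle
    refine hc0 (eq_zero_of_P_eq_zero hxy fun z hz => ?_)
    have hz' : z ∈ Ioo (-1 : ℝ) 1 := ⟨hx.1.trans hz.1, hz.2.trans hy⟩
    have e : ψ =ᶠ[𝓝 z] fun _ => 0 := by
      filter_upwards [Ioo_mem_nhds hz.1 hz.2] with t ht
      have ht' : t ∈ Ioo (-1 : ℝ) 1 := ⟨hx.1.trans ht.1, ht.2.trans hy⟩
      have h1 := hmono hx ht' ht.1.le
      have h2 := hmono ht' hy' ht.2.le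
      linarith
    have := ((hψd z hz').congr_of_eventuallyEq e.symm).unique (hasDerivAt_const z 0)
    have ha := one_sub_sq_pos hz'
    rcases mul_eq_zero.1 this with h1 | h1
    · exact absurd h1 (hφ z hz').ne'
    · exact (div_eq_zero_iff.1 h1).resolve_right (by positivity)
  rw [hψ y hy'] at hψy
  have ha := one_sub_sq_pos hy'
  have := (mul_pos_iff_of_pos_left (hφ y hy')).1 hψy
  exact (div_pos_iff_of_pos_right (by positivity)).1 this

lemma IsSolution.zero_unique {ν : ℝ} {c : ℝ × ℝ × ℝ} {U : ℝ → ℝ} (h : IsSolution ν c U)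
    (hν : 0 < ν) (hc : c ∈ J0) (hc0 : c ≠ 0) {x y : ℝ} (hx : x ∈ Ioo (-1 : ℝ) 1)
    (hy : y ∈ Ioo (-1 : ℝ) 1) (hUx : U x = 0) (hUy : U y = 0) : x = y := by
  rcases lt_trichotomy x y with hxy | hxy | hxy
  · exact absurd hUy (h.pos_of_zero hν hc hc0 hx hUx hxy hy.2).ne'
  · exact hxy
  · exact absurd hUx (h.pos_of_zero hν hc hc0 hy hUy hxy hx.2).ne'

/-- If `c₁ > 0`, a positive solution is the upper solution. -/
lemma IsSolution.isUpperSolution_of_pos {ν : ℝ} {c : ℝ × ℝ × ℝ} {U : ℝ → ℝ}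
    (h : IsSolution ν c U) (hν : 0 < ν) (hc : c ∈ J0) (hc1 : 0 < c.1)
    (hU : ∀ x ∈ Ioo (-1 : ℝ) 1, 0 < U x) : IsUpperSolution ν c U := by
  refine ⟨h, fun V hV z hz => ?_⟩
  by_contra! hlt
  obtain ⟨φ, ψ, hφ, hφd, hψ, hψd⟩ := h.exists_linearization hν
  obtain ⟨χ, ω, hχ, hχd, hω, hωd⟩ := hV.exists_linearization hν
  have hdiff : ∀ x ∈ Ioo (-1 : ℝ) 1, ω x * φ x - ψ x * χ x =
      φ x * χ x * (V x - U x) / (2 * ν * (1 - x ^ 2)) := fun x hx => by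
    rw [hψ x hx, hω x hx]; ring
  -- `φ` and `χ` solve the same second order linear equation, so their Wronskian is constant. Its
  -- sign at `z` therefore gives `V > U` everywhere.
  have hconst : ∀ x ∈ Ioo (-1 : ℝ) 1, ω x * φ x - ψ x * χ x = ω z * φ z - ψ z * χ z := by
    intro x hx
    have hd : ∀ y ∈ Ioo (-1 : ℝ) 1, HasDerivAt (fun y => ω y * φ y - ψ y * χ y) 0 y := by
      intro y hy
      refine (((hωd y hy).mul (hφd y hy)).sub ((hψd y hy).mul (hχd y hy))).congr_deriv ?_
      ring
    exact isOpen_Ioo.is_const_of_deriv_eq_zero isPreconnected_Ioo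
      (fun y hy => (hd y hy).differentiableAt.differentiableWithinAt)
      (fun y hy => (hd y hy).deriv) hx hz
  have hWz : 0 < ω z * φ z - ψ z * χ z := by
    rw [hdiff z hz]
    have := one_sub_sq_pos hz
    have := hφ z hz
    have := hχ z hz
    have : 0 < V z - U z := by linarith
    positivity
  have hVU : ∀ x ∈ Ioo (-1 : ℝ) 1, 0 < V x := fun x hx => by
    have h1 := hWz
    rw [← hconst x hx, hdiff x hx] at h1
    have h2 := (div_pos_iff_of_pos_right (by have := one_sub_sq_pos hx; positivity)).1 h1
    have := (mul_pos_iff_of_pos_left (mul_pos (hφ x hx) (hχ x hx))).1 h2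
    linarith [hU x hx]
  have hnn : ∀ x ∈ Ioo (-1 : ℝ) 1, 0 ≤ P c x / (2 * ν ^ 2 * (1 - x ^ 2) ^ 2) := fun x hx =>
    div_nonneg (P_nonneg hc (Ioo_subset_Icc_self hx)) (by positivity)
  -- near `-1` the positive functions `φ` and `χ` increase from `0`
  have hP : ∀ᶠ x in 𝓝[>] (-1 : ℝ), c.1 < P c x := by
    have : Tendsto (P c) (𝓝[>] (-1 : ℝ)) (𝓝 (P c (-1))) :=
      ((continuous_P c).tendsto (-1)).mono_left nhdsWithin_le_nhds
    refine this.eventually (lt_mem_nhds ?_)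
    unfold P; linarith
  obtain ⟨r, hr, hrP⟩ := (mem_nhdsGT_iff_exists_Ioo_subset' (show (-1 : ℝ) < 0 by norm_num)).1 hP
  have hr' : (-1 : ℝ) < min r 0 := lt_min hr (by norm_num)
  have hsmall : ∀ (f g : ℝ → ℝ), (∀ x ∈ Ioo (-1 : ℝ) 1, 0 < f x) → (∀ x ∈ Ioo (-1 : ℝ) 1, 0 < g x) →
      MonotoneOn f (Ioo (-1) 1) →
      (∀ x ∈ Ioo (-1 : ℝ) 1,
        HasDerivAt g (f x * (P c x / (2 * ν ^ 2 * (1 - x ^ 2) ^ 2))) x) →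
      ∀ l > 0, ∀ᶠ x in 𝓝[>] (-1 : ℝ), f x < l := by
    intro f g hf hg hfm hgd l hl
    suffices H : ∃ x ∈ Ioo (-1 : ℝ) 1, f x < l by
      obtain ⟨x, hx, hfx⟩ := H
      filter_upwards [Ioo_mem_nhdsGT hx.1] with y hy
      exact (hfm ⟨hy.1, hy.2.trans hx.2⟩ hx hy.2.le).trans_lt hfx
    by_contra! hge
    -- If `f ≥ l`, then `P_c > c₁` and `(1-x²)² ≤ 4(1+x)²` give `g' ≥ κ/(1+x)²` near `-1`. So `g +
    -- κ/(1+x)` is increasing there, and `g` would tend to `-∞` at `-1`, against `g > 0`.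
    set κ := l * c.1 / (8 * ν ^ 2) with hκ
    have hκ0 : 0 < κ := by positivity
    have hm : MonotoneOn (fun x => g x + κ * (1 + x)⁻¹) (Ioo (-1) (min r 0)) := by
      refine monotoneOn_of_hasDerivAt_nonneg (f' := fun x =>
        f x * (P c x / (2 * ν ^ 2 * (1 - x ^ 2) ^ 2)) + κ * (-1 / (1 + x) ^ 2)) ?_ ?_
      · intro x hx
        have hx' : x ∈ Ioo (-1 : ℝ) 1 := ⟨hx.1, by linarith [hx.2, min_le_right r 0]⟩
        exact (hgd x hx').add
          ((((hasDerivAt_id' x).const_add 1).fun_inv (by linarith [hx.1])).const_mul κ)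
      · intro x hx
        have hx' : x ∈ Ioo (-1 : ℝ) 1 := ⟨hx.1, by linarith [hx.2, min_le_right r 0]⟩
        have hxP : c.1 < P c x := hrP ⟨hx.1, hx.2.trans_le (min_le_left _ _)⟩
        have ha := one_sub_sq_pos hx'
        have h1 : 0 < 1 + x := by linarith [hx.1]
        have h4 : (1 - x ^ 2) ^ 2 ≤ 4 * (1 + x) ^ 2 := by
          have : 1 - x ^ 2 ≤ 2 * (1 + x) := by nlinarith [hx'.2]
          nlinarith
        have h2 : l * (c.1 / (2 * ν ^ 2 * (4 * (1 + x) ^ 2))) ≤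
            f x * (P c x / (2 * ν ^ 2 * (1 - x ^ 2) ^ 2)) := by
          have := hge x hx'
          have := hf x hx'
          have : 0 ≤ P c x := (hc1.trans hxP).le
          gcongr
        have h3 : l * (c.1 / (2 * ν ^ 2 * (4 * (1 + x) ^ 2))) = κ * (1 / (1 + x) ^ 2) := by
          rw [hκ]; field_simp; norm_num
        rw [neg_div]
        linarith
    have hlim : Tendsto (fun x : ℝ => κ * (1 + x)⁻¹) (𝓝[>] (-1)) atTop := by
      refine Tendsto.const_mul_atTop hκ0 (tendsto_inv_nhdsGT_zero.comp ?_)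
      refine tendsto_nhdsWithin_iff.2 ⟨?_, ?_⟩
      · have : Tendsto (fun a : ℝ => 1 + a) (𝓝 (-1)) (𝓝 (1 + -1)) := by
          apply Continuous.tendsto; fun_prop
        rw [add_neg_cancel] at this
        exact this.mono_left nhdsWithin_le_nhds
      · filter_upwards [self_mem_nhdsWithin] with a ha
        have : -1 < a := ha
        show 0 < 1 + a
        linarith
    obtain ⟨y, hy1, hy2⟩ := exists_between hr'
    obtain ⟨x, hx1, hx2⟩ := ((hlim.eventually_gt_atTop (g y + κ * (1 + y)⁻¹)).and
      (Ioo_mem_nhdsGT hy1)).exists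
    have h1 := hm ⟨hx2.1, hx2.2.trans hy2⟩ ⟨hy1, hy2⟩ hx2.2.le
    have h2 := hg x ⟨hx2.1, by linarith [hx2.2, min_le_right r 0]⟩
    simp only at h1
    linarith
  have hψ0 : ∀ x ∈ Ioo (-1 : ℝ) 1, 0 < ψ x := fun x hx => by
    rw [hψ x hx]
    have := one_sub_sq_pos hx
    have := hφ x hx
    have := hU x hx
    positivity
  have hω0 : ∀ x ∈ Ioo (-1 : ℝ) 1, 0 < ω x := fun x hx => by
    rw [hω x hx]
    have := one_sub_sq_pos hx
    have := hχ x hx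
    have := hVU x hx
    positivity
  have hωm : MonotoneOn ω (Ioo (-1) 1) := monotoneOn_of_hasDerivAt_nonneg hωd (fun x hx =>
    mul_nonneg (hχ x hx).le (hnn x hx))
  have hφs := hsmall φ ψ hφ hψ0 (monotoneOn_of_hasDerivAt_nonneg hφd (fun x hx => (hψ0 x hx).le))
    hψd ((ω z * φ z - ψ z * χ z) / ω z) (div_pos hWz (hω0 z hz))
  -- Near `-1` the positive Wronskian is below `ω φ ≤ ω(z) φ`, which is smaller than its constant
  -- value once `φ` is small enough.
  obtain ⟨x, hx1, hx2⟩ := (hφs.and (Ioo_mem_nhdsGT hz.1)).exists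
  have hx : x ∈ Ioo (-1 : ℝ) 1 := ⟨hx2.1, hx2.2.trans hz.2⟩
  have h1 := hconst x hx
  have h2 := hωm hx hz hx2.2.le
  rw [lt_div_iff₀ (hω0 z hz)] at hx1
  have h3 : 0 < ψ x * χ x := mul_pos (hψ0 x hx) (hχ x hx)
  have h4 : ω x * φ x ≤ ω z * φ x := mul_le_mul_of_nonneg_right h2 (hφ x hx).le
  linarith

lemma IsSolution.isLowerSolution_of_neg {ν : ℝ} {c : ℝ × ℝ × ℝ} {U : ℝ → ℝ}
    (h : IsSolution ν c U) (hν : 0 < ν) (hc : c ∈ J0) (hc2 : 0 < c.2.1)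
    (hU : ∀ x ∈ Ioo (-1 : ℝ) 1, U x < 0) : IsLowerSolution ν c U := by
  have := (h.reflect.isUpperSolution_of_pos hν (refl_mem_J0 hc) hc2
    (fun x hx => neg_pos.2 (hU (-x) (neg_mem_Ioo_one hx)))).reflect
  simpa using this

/-- A solution without zeros has a constant sign. -/
lemma IsSolution.pos_or_neg {ν : ℝ} {c : ℝ × ℝ × ℝ} {U : ℝ → ℝ} (h : IsSolution ν c U)
    (hU : ∀ x ∈ Ioo (-1 : ℝ) 1, U x ≠ 0) :
    (∀ x ∈ Ioo (-1 : ℝ) 1, 0 < U x) ∨ ∀ x ∈ Ioo (-1 : ℝ) 1, U x < 0 := by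
  by_contra! H
  obtain ⟨⟨x, hx, hUx⟩, y, hy, hUy⟩ := H
  obtain ⟨z, hz, hUz⟩ := isPreconnected_Ioo.intermediate_value hx hy h.1.continuousOn ⟨hUx, hUy⟩
  exact hU z hz hUz

/-! ### The error `U²/2 - P_c` to the right of a zero -/

/-- While `y ≥ Y`, the damping `b y` exceeds twice the source, so `y` falls at rate at least
`b₀Y/(2ν)`. A starting value as large as order `1/ν` is therefore brought below `Y` over an interval
of fixed length. The same argument applies to `-y`. -/
lemma abs_le_of_linear_decay {y g a b : ℝ → ℝ} {ν x₀ x₁ b₀ M Y : ℝ} (hν : 0 < ν) (hx : x₀ ≤ x₁)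
    (hd : ∀ x ∈ Icc x₀ x₁, HasDerivAt y ((g x - b x * y x) / (ν * a x)) x)
    (ha : ∀ x ∈ Icc x₀ x₁, 0 < a x ∧ a x ≤ 1) (hb0 : 0 < b₀) (hb : ∀ x ∈ Icc x₀ x₁, b₀ ≤ b x)
    (hg : ∀ x ∈ Icc x₀ x₁, |g x| ≤ M) (hMY : 2 * M < b₀ * Y)
    (h0 : 2 * (ν * |y x₀|) ≤ b₀ * Y * (x₁ - x₀)) : |y x₁| ≤ Y := by
  have hM : 0 ≤ M := (abs_nonneg _).trans (hg x₀ ⟨le_rfl, hx⟩)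
  have hY : 0 < Y := by
    by_contra! h
    nlinarith [mul_nonneg hb0.le (neg_nonneg.2 h)]
  have key : ∀ z f : ℝ → ℝ, (∀ x ∈ Icc x₀ x₁, HasDerivAt z ((f x - b x * z x) / (ν * a x)) x) →
      (∀ x ∈ Icc x₀ x₁, f x ≤ M) → 2 * (ν * z x₀) ≤ b₀ * Y * (x₁ - x₀) → z x₁ ≤ Y := by
    intro z f hz hf hz0
    refine le_of_decay (k := b₀ * Y / (2 * ν)) hx (by positivity) hz ?_ ?_
    · have : z x₀ ≤ b₀ * Y / (2 * ν) * (x₁ - x₀) := by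
        rw [div_mul_eq_mul_div, le_div_iff₀ (by positivity)]
        linarith
      linarith
    · intro x hxI hYz
      have h1 := ha x hxI
      have h2 : b₀ * Y ≤ b x * z x := mul_le_mul (hb x hxI) hYz hY.le (hb0.le.trans (hb x hxI))
      have h3 := hf x hxI
      rw [div_lt_iff₀ (mul_pos hν h1.1)]
      have e : -(b₀ * Y / (2 * ν)) * (ν * a x) = -(b₀ * Y / 2 * a x) := by field_simp
      have : b₀ * Y / 2 * a x ≤ b₀ * Y / 2 * 1 := by gcongr; exact h1.2
      rw [e]
      linarith
  rw [abs_le]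
  constructor
  · have := key (fun x => -y x) (fun x => -g x)
      (fun x hxI => ((hd x hxI).fun_neg).congr_deriv (by ring))
      (fun x hxI => (neg_le_abs _).trans (hg x hxI))
      (le_trans (by gcongr; exact neg_le_abs _) h0)
    linarith
  · exact key y g hd (fun x hxI => (le_abs_self _).trans (hg x hxI))
      (le_trans (by gcongr; exact le_abs_self _) h0)

/-- The equation replaces the nonlinear part of `ν(1-x²)(U²/2)'`, so the error is damped with rate
`U/(ν(1-x²))`; the remaining terms carry a factor `ν`. -/
lemma IsSolution.hasDerivAt_error {ν : ℝ} {c : ℝ × ℝ × ℝ} {U : ℝ → ℝ} (h : IsSolution ν c U)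
    (hν : 0 < ν) {x : ℝ} (hx : x ∈ Ioo (-1 : ℝ) 1) :
    HasDerivAt (fun x => U x ^ 2 / 2 - P c x)
      (-(U x * (U x ^ 2 / 2 - P c x) + 2 * ν * x * U x ^ 2 + ν * (1 - x ^ 2) * dP c x) /
        (ν * (1 - x ^ 2))) x := by
  have ha := one_sub_sq_pos hx
  refine ((((h.hasDerivAt hν hx).fun_pow 2).div_const 2).fun_sub (hasDerivAt_P c x)).congr_deriv ?_
  field_simp
  push_cast
  ring

/-- With `ν = τ³` and `u ≥ τ`, damping beats the source for an error of size `Kτ²`: both source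
terms are bounded by multiples of `τ²u`, and at least half of `Kτ²u` survives. -/
lemma decay_numerator_ge {τ u M K X y p B a : ℝ} (hτ : 0 < τ) (hτ1 : τ ≤ 1) (hu : τ ≤ u) (huM : u ≤ M)
    (hX : K * τ ^ 2 ≤ X) (hy : |y| ≤ 1) (hp : |p| ≤ B) (ha0 : 0 < a) (ha : a ≤ 1)
    (hK : 4 * M + 2 * B ≤ K) :
    K / 2 * τ ^ 3 ≤ u * X + 2 * τ ^ 3 * y * u ^ 2 + τ ^ 3 * a * p := by
  have hu0 : 0 < u := hτ.trans_le hu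
  have hB : 0 ≤ B := (abs_nonneg _).trans hp
  have h1 : u * (K * τ ^ 2) ≤ u * X := by gcongr
  have h2 : -(τ ^ 2 * u * M) ≤ τ ^ 3 * y * u ^ 2 := by
    have e1 : τ ^ 3 * u ^ 2 ≤ τ ^ 2 * u * M := by
      have : τ ^ 2 * u * (τ * u) ≤ τ ^ 2 * u * (1 * M) := by gcongr
      linarith
    have e2 : -(τ ^ 3 * u ^ 2) ≤ τ ^ 3 * u ^ 2 * y := by
      have := mul_le_mul_of_nonneg_left (abs_le.1 hy).1 (show 0 ≤ τ ^ 3 * u ^ 2 by positivity)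
      linarith
    linarith
  have h3 : -(τ ^ 2 * u * B) ≤ τ ^ 3 * a * p := by
    have e1 : τ ^ 2 * (τ * (a * B)) ≤ τ ^ 2 * (u * (1 * B)) := by gcongr
    have e2 := mul_le_mul_of_nonneg_left (abs_le.1 hp).1 (show 0 ≤ τ ^ 3 * a by positivity)
    linarith
  have hK0 : 0 ≤ K := by linarith
  have h4 : K / 2 * (τ ^ 2 * τ) ≤ K / 2 * (τ ^ 2 * u) := by gcongr
  have h5 : 0 ≤ (K / 2 - 2 * M - B) * (τ ^ 2 * u) := by
    apply mul_nonneg <;> [linarith; positivity]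
  nlinarith

/-- The error `U²/2 - P_c` is of order `ν^(2/3)` to the right of the first layer. -/
lemma IsSolution.abs_error_le {τ : ℝ} {c : ℝ × ℝ × ℝ} {U : ℝ → ℝ} {s B ε K : ℝ}
    (h : IsSolution (τ ^ 3) c U) (hc : c ∈ J0) (hτ : 0 < τ) (hτ1 : τ ≤ 1) (hs : -1 ≤ s)
    (hU : ∀ x ∈ Ioo s 1, 0 < U x) (hB1 : 1 ≤ B) (hB : bound c ≤ B) (hε : 0 < ε)
    (hK : 34 * B + 8 * (64 * B ^ 2 + 8) / ε ≤ K) {x₁ : ℝ} (hx₁ : x₁ ∈ Ioo (s + ε) 1) :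
    (0 < U x₁ ∧ U x₁ ≤ 8 * B) ∧ |U x₁ ^ 2 / 2 - P c x₁| ≤ (K + 8) * τ ^ 2 := by
  have hν : 0 < τ ^ 3 := by positivity
  have hν1 : τ ^ 3 ≤ 1 := pow_le_one₀ hτ.le hτ1
  -- The level `8B` meets both barrier conditions, since `8ν ≤ 8 ≤ 8B` and `8P ≤ 8B ≤ (8B)²`.
  have hUM : ∀ x ∈ Ioo (-1 : ℝ) 1, U x ≤ 8 * B := fun x hx =>
    h.le_of_barrier hν hx (by linarith) (fun y hy => by
      have := (le_abs_self _).trans (abs_P_le c ⟨hy.1.le, hy.2.trans hx.2.le⟩)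
      nlinarith)
  -- Decay of slope `K/4` over the length `ε/2` absorbs the initial error, of size at most `64B² +
  -- 8`; hence the term with `1/ε` in the bound on `K`. The term `34B` is what `decay_numerator_ge`
  -- needs for `M = 8B`.
  set x₀ := x₁ - ε / 2 with hx₀
  have hx01 : x₀ ≤ x₁ := by linarith
  have hI : ∀ x ∈ Icc x₀ x₁, x ∈ Ioo s 1 := fun x hx =>
    ⟨by linarith [hx.1, hx₁.1], hx.2.trans_lt hx₁.2⟩
  have hJ : ∀ x ∈ Icc x₀ x₁, x ∈ Ioo (-1 : ℝ) 1 := fun x hx =>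
    ⟨hs.trans_lt (hI x hx).1, (hI x hx).2⟩
  have hPB : ∀ x ∈ Icc x₀ x₁, |P c x| ≤ B := fun x hx =>
    (abs_P_le c (Ioo_subset_Icc_self (hJ x hx))).trans hB
  have hdB : ∀ x ∈ Icc x₀ x₁, |dP c x| ≤ B := fun x hx =>
    (abs_dP_le c (Ioo_subset_Icc_self (hJ x hx))).trans hB
  have hP0 : ∀ x ∈ Icc x₀ x₁, 0 ≤ P c x := fun x hx =>
    P_nonneg hc (Ioo_subset_Icc_self (hJ x hx))
  have hx : ∀ x ∈ Icc x₀ x₁, |x| ≤ 1 := fun x hx =>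
    abs_le.2 ⟨(hJ x hx).1.le, (hJ x hx).2.le⟩
  have hK1 : 34 * B ≤ K := by
    have : 0 ≤ 8 * (64 * B ^ 2 + 8) / ε := by positivity
    linarith
  have hKpos : 0 < K := by linarith
  have hK2 : 64 * B ^ 2 + 8 ≤ K / 4 * (x₁ - x₀) := by
    have h1 : 8 * (64 * B ^ 2 + 8) / ε ≤ K := by linarith
    rw [div_le_iff₀ hε] at h1
    have : x₁ - x₀ = ε / 2 := by rw [hx₀]; ring
    rw [this]
    linarith
  have hx0 : x₀ ∈ Icc x₀ x₁ := ⟨le_rfl, hx01⟩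
  have hx1 : x₁ ∈ Icc x₀ x₁ := ⟨hx01, le_rfl⟩
  refine ⟨⟨hU _ (hI _ hx1), hUM _ (hJ _ hx1)⟩, abs_le.2 ⟨?_, ?_⟩⟩
  -- For the lower bound on the error, `U` may be below `τ`, where damping is too weak. The
  -- corrector `8τ³/(τ+U)` costs at most `8τ²` and decreases when `U` grows.
  · have hd : ∀ x ∈ Icc x₀ x₁, HasDerivAt
        (fun x => -(U x ^ 2 / 2 - P c x) + 8 * τ ^ 3 * (τ + U x)⁻¹) _ x := fun x hx =>
      ((h.hasDerivAt_error hν (hJ x hx)).fun_neg).fun_add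
        ((((h.hasDerivAt hν (hJ x hx)).const_add τ).fun_inv
          (by linarith [hU x (hI x hx)])).const_mul (8 * τ ^ 3))
    have hlay : ∀ x ∈ Icc x₀ x₁, 8 * τ ^ 3 * (τ + U x)⁻¹ ≤ 8 * τ ^ 2 := fun x hx => by
      have := hU x (hI x hx)
      rw [← div_eq_mul_inv, div_le_iff₀ (by positivity)]
      have : 0 ≤ τ ^ 2 * U x := by positivity
      nlinarith
    have := le_of_decay (m := (K + 8) * τ ^ 2) (k := K / 4) hx01 (by linarith) hd ?_ ?_
    · have h2 : 0 ≤ 8 * τ ^ 3 * (τ + U x₁)⁻¹ := by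
        have := hU x₁ (hI x₁ hx1)
        positivity
      linarith
    · have h1 := hlay x₀ hx0
      have h2 := (abs_le.1 (hPB x₀ hx0)).2
      have h3 : τ ^ 2 ≤ 1 := pow_le_one₀ hτ.le hτ1
      have h4 : 0 ≤ (K + 8) * τ ^ 2 := mul_nonneg (by linarith) (by positivity)
      nlinarith [sq_nonneg (U x₀)]
    · intro x hxI hle
      have hUx := hU x (hI x hxI)
      have ha := one_sub_sq_pos (hJ x hxI)
      have ha1 : 1 - x ^ 2 ≤ 1 := by nlinarith [sq_nonneg x]
      have hG : K * τ ^ 2 ≤ P c x - U x ^ 2 / 2 := by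
        have := hlay x hxI
        linarith
      have hU' : K / (2 * τ) ≤
          (P c x - U x ^ 2 / 2 - 2 * τ ^ 3 * x * U x) / (τ ^ 3 * (1 - x ^ 2)) := by
        have e1 : 2 * τ ^ 3 * x * U x ≤ K / 2 * τ ^ 2 := by
          have e2 : τ ^ 2 * (τ * (x * U x)) ≤ τ ^ 2 * (1 * (1 * (8 * B))) := by
            have := hUM x (hJ x hxI)
            have := (hJ x hxI).2.le
            have : x * U x ≤ 1 * (8 * B) := by nlinarith
            have : τ * (x * U x) ≤ 1 * (1 * (8 * B)) := by nlinarith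
            gcongr
          have e3 : 16 * B * τ ^ 2 ≤ K / 2 * τ ^ 2 := by gcongr; linarith
          linarith
        rw [le_div_iff₀ (by positivity)]
        have e4 : K / (2 * τ) * (τ ^ 3 * (1 - x ^ 2)) = K / 2 * τ ^ 2 * (1 - x ^ 2) := by
          field_simp
        have e5 : K / 2 * τ ^ 2 * (1 - x ^ 2) ≤ K / 2 * τ ^ 2 * 1 := by gcongr
        rw [e4]
        linarith
      set D := (P c x - U x ^ 2 / 2 - 2 * τ ^ 3 * x * U x) / (τ ^ 3 * (1 - x ^ 2)) with hD
      have hD0 : 0 ≤ D := le_trans (div_nonneg (by linarith) (by positivity)) hU'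
      rcases le_or_gt τ (U x) with hτU | hτU
      · have h1 := decay_numerator_ge (M := 8 * B) (y := -x) (p := -dP c x) (B := B) (K := K) hτ hτ1 hτU
          (hUM x (hJ x hxI)) hG (by rw [abs_neg]; exact hx x hxI)
          (by rw [abs_neg]; exact hdB x hxI) ha ha1 (by linarith)
        have h2 : -(-(U x * (U x ^ 2 / 2 - P c x) + 2 * τ ^ 3 * x * U x ^ 2 +
            τ ^ 3 * (1 - x ^ 2) * dP c x) / (τ ^ 3 * (1 - x ^ 2))) < -(K / 4) := by
          rw [neg_div, neg_neg, div_lt_iff₀ (by positivity)]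
          have e6 : K / 4 * τ ^ 3 * (1 - x ^ 2) ≤ K / 4 * τ ^ 3 * 1 := by gcongr
          have e7 : 0 < K * τ ^ 3 := mul_pos (by linarith) hν
          linarith
        have h3 : 8 * τ ^ 3 * (-D / (τ + U x) ^ 2) ≤ 0 := by
          rw [neg_div, mul_neg, neg_nonpos]
          positivity
        linarith
      · have h1 : -(-(U x * (U x ^ 2 / 2 - P c x) + 2 * τ ^ 3 * x * U x ^ 2 +
            τ ^ 3 * (1 - x ^ 2) * dP c x) / (τ ^ 3 * (1 - x ^ 2))) = dP c x - U x * D := by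
          rw [hD]; field_simp; ring
        have h2 : 0 ≤ U x * D := mul_nonneg hUx.le hD0
        -- For `U < τ` the slope `D ≥ K/(2τ)` of `U` makes the corrector fall at rate at least `8τ³
        -- · K/(2τ) / (2τ)² = K`, which dominates `P_c'`.
        have h3 : K ≤ 8 * τ ^ 3 * (D / (τ + U x) ^ 2) := by
          have : 8 * τ ^ 3 * (K / (2 * τ) / (2 * τ) ^ 2) ≤ 8 * τ ^ 3 * (D / (τ + U x) ^ 2) := by
            gcongr
            linarith
          refine le_trans (le_of_eq ?_) this
          field_simp
          norm_num
        rw [h1, neg_div, mul_neg]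
        have := (abs_le.1 (hdB x hxI)).2
        linarith
  · have h8 : K * τ ^ 2 ≤ (K + 8) * τ ^ 2 := by gcongr; linarith
    refine le_trans ?_ h8
    refine le_of_decay (f := fun x => U x ^ 2 / 2 - P c x) (k := K / 4) hx01 (by linarith)
      (fun x hx => h.hasDerivAt_error hν (hJ x hx)) ?_ ?_
    · have h2 := hUM x₀ (hJ x₀ hx0)
      have h3 := hU x₀ (hI x₀ hx0)
      have h4 : 0 ≤ K * τ ^ 2 := mul_nonneg (by linarith) (by positivity)
      have h5 := hP0 x₀ hx0
      have h6 : U x₀ ^ 2 ≤ (8 * B) ^ 2 := by gcongr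
      nlinarith
    · intro x hxI hle
      have hUx := hU x (hI x hxI)
      have ha := one_sub_sq_pos (hJ x hxI)
      have ha1 : 1 - x ^ 2 ≤ 1 := by nlinarith [sq_nonneg x]
      -- For the upper bound no corrector is needed: an error of at least `Kτ²` already forces `U ≥
      -- τ`.
      have hτU : τ ≤ U x := by
        have h5 := hP0 x hxI
        have : τ ^ 2 ≤ K * τ ^ 2 := le_mul_of_one_le_left (by positivity) (by linarith)
        exact le_of_sq_le_sq (by nlinarith [sq_nonneg (U x)]) hUx.le
      have h1 := decay_numerator_ge (M := 8 * B) (y := x) (p := dP c x) (B := B) (K := K) hτ hτ1 hτU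
        (hUM x (hJ x hxI)) hle (hx x hxI) (hdB x hxI) ha ha1 (by linarith)
      rw [neg_div, neg_lt_neg_iff, lt_div_iff₀ (by positivity)]
      have e6 : K / 4 * τ ^ 3 * (1 - x ^ 2) ≤ K / 4 * τ ^ 3 * 1 := by gcongr
      have e7 : 0 < K * τ ^ 3 := mul_pos (by linarith) hν
      linarith

/-- Where `P_c` is bounded below, the error improves to order `ν`. -/
lemma IsSolution.abs_error_le_linear {ν : ℝ} {c : ℝ × ℝ × ℝ} {U : ℝ → ℝ} {B u₀ Y E x₀ x₁ : ℝ}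
    (h : IsSolution ν c U) (hν : 0 < ν) (hx₀ : -1 < x₀) (hx : x₀ ≤ x₁) (hx₁ : x₁ < 1)
    (hB : bound c ≤ B) (hu₀ : 0 < u₀) (hU : ∀ x ∈ Icc x₀ x₁, u₀ ≤ U x ∧ U x ≤ 8 * B)
    (hE : |U x₀ ^ 2 / 2 - P c x₀| ≤ E) (hY : 2 * (128 * B ^ 2 + B) < u₀ * Y)
    (hYE : 2 * E ≤ u₀ * Y * (x₁ - x₀)) :
    |U x₁ ^ 2 / 2 - P c x₁| ≤ Y * ν := by
  have hJ : ∀ x ∈ Icc x₀ x₁, x ∈ Ioo (-1 : ℝ) 1 := fun x hx =>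
    ⟨hx₀.trans_le hx.1, hx.2.trans_lt hx₁⟩
  -- After division by `ν` the error has a source of order one.
  have := abs_le_of_linear_decay (y := fun x => (U x ^ 2 / 2 - P c x) / ν)
    (g := fun x => -(2 * x * U x ^ 2 + (1 - x ^ 2) * dP c x)) (a := fun x => 1 - x ^ 2) (b := U)
    (M := 128 * B ^ 2 + B) (Y := Y) hν hx ?_ ?_ hu₀ (fun x hx => (hU x hx).1) ?_ hY ?_
  · rw [abs_div, abs_of_pos hν, div_le_iff₀ hν] at this
    exact this
  · intro x hxI
    have ha := one_sub_sq_pos (hJ x hxI)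
    refine ((h.hasDerivAt_error hν (hJ x hxI)).div_const ν).congr_deriv ?_
    field_simp
    ring
  · intro x hxI
    exact ⟨one_sub_sq_pos (hJ x hxI), by nlinarith [sq_nonneg x]⟩
  · intro x hxI
    have h1 := hU x hxI
    have h2 := (abs_dP_le c (Ioo_subset_Icc_self (hJ x hxI))).trans hB
    have ha := one_sub_sq_pos (hJ x hxI)
    have hB0 : 0 ≤ B := (abs_nonneg _).trans h2
    rw [abs_neg]
    refine (abs_add_le _ _).trans ?_
    have e1 : |2 * x * U x ^ 2| ≤ 2 * 1 * (8 * B) ^ 2 := by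
      have : 0 ≤ U x := by linarith
      rw [abs_mul, abs_mul, abs_two, abs_of_nonneg (sq_nonneg (U x))]
      gcongr
      · exact abs_le.2 ⟨(hJ x hxI).1.le, (hJ x hxI).2.le⟩
      · exact h1.2
    have e2 : |(1 - x ^ 2) * dP c x| ≤ 1 * B := by
      rw [abs_mul, abs_of_pos ha]
      gcongr
      nlinarith [sq_nonneg x]
    linarith
  · rw [abs_div, abs_of_pos hν, mul_div_cancel₀ _ hν.ne']
    linarith

/-! ### Uniform statements as the parameters converge -/

/-- A parameter `ν`, a parameter `c`, a solution, and a left end point. -/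
structure Datum where
  nu : ℝ
  par : ℝ × ℝ × ℝ
  sol : ℝ → ℝ
  left : ℝ

/-- The solution of the datum is positive between the left end point and `1`. -/
structure Datum.Admissible (d : Datum) : Prop where
  nu_pos : 0 < d.nu
  par_mem : d.par ∈ J0
  solution : IsSolution d.nu d.par d.sol
  left_ge : -1 ≤ d.left
  pos : ∀ x ∈ Ioo d.left 1, 0 < d.sol x

/-- Convergence `ν → 0` and `c' → c` along admissible data. -/
def admFilter (c : ℝ × ℝ × ℝ) : Filter Datum :=
  comap Datum.nu (𝓝 0) ⊓ comap Datum.par (𝓝 c) ⊓ 𝓟 {d | d.Admissible}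

variable {c : ℝ × ℝ × ℝ}

lemma eventually_admissible (c : ℝ × ℝ × ℝ) : ∀ᶠ d in admFilter c, d.Admissible :=
  mem_inf_of_right (mem_principal_self _)

lemma tendsto_nu (c : ℝ × ℝ × ℝ) : Tendsto Datum.nu (admFilter c) (𝓝 0) :=
  tendsto_comap.mono_left (inf_le_left.trans inf_le_left)

lemma tendsto_par (c : ℝ × ℝ × ℝ) : Tendsto Datum.par (admFilter c) (𝓝 c) :=
  tendsto_comap.mono_left (inf_le_left.trans inf_le_right)

lemma eventually_nu_lt (c : ℝ × ℝ × ℝ) {δ : ℝ} (hδ : 0 < δ) : ∀ᶠ d in admFilter c, d.nu < δ :=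
  (tendsto_nu c).eventually_lt_const hδ

lemma eventually_bound_le (c : ℝ × ℝ × ℝ) : ∀ᶠ d in admFilter c, bound d.par ≤ bound c + 1 :=
  (((continuous_bound.tendsto c).comp (tendsto_par c)).eventually_lt_const
    (lt_add_one (bound c))).mono fun _ h => le_of_lt h

lemma tendsto_admFilter {ι : Type*} {l : Filter ι} {f : ι → Datum}
    (h1 : Tendsto (fun i => (f i).nu) l (𝓝 0)) (h2 : Tendsto (fun i => (f i).par) l (𝓝 c))
    (h3 : ∀ᶠ i in l, (f i).Admissible) : Tendsto f l (admFilter c) :=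
  tendsto_inf.2 ⟨tendsto_inf.2 ⟨tendsto_comap_iff.2 h1, tendsto_comap_iff.2 h2⟩,
    tendsto_principal.2 h3⟩

lemma bound_nonneg (c : ℝ × ℝ × ℝ) : 0 ≤ bound c := by unfold bound; positivity

lemma P_sub (c c' : ℝ × ℝ × ℝ) (x : ℝ) : P c' x - P c x = P (c' - c) x := by
  simp [P]; ring

lemma tendsto_bound_sub (c : ℝ × ℝ × ℝ) : Tendsto (fun c' => bound (c' - c)) (𝓝 c) (𝓝 0) := by
  have : Tendsto (fun c' => bound (c' - c)) (𝓝 c) (𝓝 (bound (c - c))) :=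
    (continuous_bound.comp (continuous_id.sub continuous_const)).tendsto c
  simpa [bound] using this

/-- A positive lower bound for `P_c` persists for nearby parameters. -/
lemma exists_pos_le_P (hP : ∀ x ∈ Icc (-1 : ℝ) 1, 0 < P c x) :
    ∃ δ > 0, ∀ᶠ c' in 𝓝 c, ∀ x ∈ Icc (-1 : ℝ) 1, δ ≤ P c' x := by
  obtain ⟨x₀, hx₀, hmin⟩ := (isCompact_Icc (a := (-1 : ℝ)) (b := 1)).exists_isMinOn
    (nonempty_Icc.2 (by norm_num))
    (continuous_P c).continuousOn
  refine ⟨P c x₀ / 2, half_pos (hP x₀ hx₀), ?_⟩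
  filter_upwards [(tendsto_bound_sub c).eventually_lt_const (half_pos (hP x₀ hx₀))] with c' hc' x hx
  have h1 : P c x₀ ≤ P c x := hmin hx
  have h2 := (abs_le.1 (abs_P_le (c' - c) hx)).1
  rw [← P_sub] at h2
  linarith

/-- The preceding estimate with `τ = ν^(1/3)`, made uniform by bounding `bound d.par` by `bound c +
1`. -/
lemma exists_error_le_two_thirds (c : ℝ × ℝ × ℝ) {ε : ℝ} (hε : 0 < ε) :
    ∃ C > 0, ∀ᶠ d in admFilter c, ∀ x ∈ Ioo (d.left + ε) 1,
      (0 < d.sol x ∧ d.sol x ≤ 8 * (bound c + 1)) ∧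
        |d.sol x ^ 2 / 2 - P d.par x| ≤ C * d.nu ^ (2 / 3 : ℝ) := by
  set B := bound c + 1 with hB
  have hB1 : 1 ≤ B := by linarith [bound_nonneg c]
  refine ⟨34 * B + 8 * (64 * B ^ 2 + 8) / ε + 8, by positivity, ?_⟩
  filter_upwards [eventually_admissible c, eventually_nu_lt c one_pos, eventually_bound_le c]
    with d hd hν hb x hx
  have h3 : (d.nu ^ (1 / 3 : ℝ)) ^ 3 = d.nu := by
    rw [← Real.rpow_natCast, ← Real.rpow_mul hd.nu_pos.le]; norm_num
  have h2 : (d.nu ^ (1 / 3 : ℝ)) ^ 2 = d.nu ^ (2 / 3 : ℝ) := by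
    rw [← Real.rpow_natCast, ← Real.rpow_mul hd.nu_pos.le]; norm_num
  have hs : IsSolution ((d.nu ^ (1 / 3 : ℝ)) ^ 3) d.par d.sol := by rw [h3]; exact hd.solution
  have := hs.abs_error_le hd.par_mem (Real.rpow_pos_of_pos hd.nu_pos _)
    (Real.rpow_le_one hd.nu_pos.le hν.le (by norm_num)) hd.left_ge hd.pos hB1 hb hε le_rfl hx
  rwa [h2] at this

/-- Bootstrap: once the `ν^(2/3)` error is below `δ/2`, the bound `P ≥ δ` gives `U ≥ √δ`. The
summand `4δ/ε` of the constant absorbs the initial error `δ/2` over a length `ε/4`. -/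
lemma exists_error_le_linear (hP : ∀ x ∈ Icc (-1 : ℝ) 1, 0 < P c x) {ε : ℝ} (hε : 0 < ε) :
    ∃ C > 0, ∀ᶠ d in admFilter c, ∀ x ∈ Ioo (d.left + ε) 1,
        |d.sol x ^ 2 / 2 - P d.par x| ≤ C * d.nu := by
  obtain ⟨δ, hδ, hPδ⟩ := exists_pos_le_P hP
  obtain ⟨C, hC, hCe⟩ := exists_error_le_two_thirds c (half_pos hε)
  have hsmall : ∀ᶠ d in admFilter c, C * d.nu ^ (2 / 3 : ℝ) < δ / 2 := by
    have h1 : Tendsto (fun d : Datum => C * d.nu ^ (2 / 3 : ℝ)) (admFilter c)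
        (𝓝 (C * 0 ^ (2 / 3 : ℝ))) :=
      ((tendsto_nu c).rpow_const (Or.inr (by norm_num))).const_mul C
    rw [Real.zero_rpow (by norm_num), mul_zero] at h1
    exact h1.eventually_lt_const (half_pos hδ)
  set B := bound c + 1 with hB
  have hB1 : 1 ≤ B := by linarith [bound_nonneg c]
  have hu : 0 < √δ := Real.sqrt_pos.2 hδ
  refine ⟨(2 * (128 * B ^ 2 + B) + 1 + 4 * δ / ε) / √δ, by positivity, ?_⟩
  filter_upwards [eventually_admissible c, eventually_bound_le c, hCe, hsmall,
    (tendsto_par c).eventually hPδ] with d hd hb hCd hsd hδd x hx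
  have hI : ∀ y ∈ Icc (x - ε / 4) x, y ∈ Ioo (d.left + ε / 2) 1 := fun y hy =>
    ⟨by linarith [hx.1, hy.1], hy.2.trans_lt hx.2⟩
  have hx0 : x - ε / 4 ∈ Icc (x - ε / 4) x := ⟨le_rfl, by linarith⟩
  have hY : √δ * ((2 * (128 * B ^ 2 + B) + 1 + 4 * δ / ε) / √δ) =
      2 * (128 * B ^ 2 + B) + 1 + 4 * δ / ε := by field_simp
  refine hd.solution.abs_error_le_linear hd.nu_pos (x₀ := x - ε / 4) (E := δ / 2) (B := B)
    (u₀ := √δ) (by linarith [hx.1, hd.left_ge]) (by linarith) hx.2 hb hu ?_ ?_ ?_ ?_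
  · intro y hy
    obtain ⟨⟨h1, h2⟩, h3⟩ := hCd y (hI y hy)
    refine ⟨?_, h2⟩
    rw [Real.sqrt_le_left h1.le]
    have h4 := hδd y ⟨by linarith [(hI y hy).1, hd.left_ge], (hI y hy).2.le⟩
    have h5 := (abs_le.1 h3).1
    linarith
  · exact ((hCd _ (hI _ hx0)).2).trans hsd.le
  · rw [hY]
    have : 0 ≤ 4 * δ / ε := by positivity
    linarith
  · rw [hY]
    have e1 : 4 * δ / ε * (ε / 4) = δ := by field_simp
    have : 0 ≤ (2 * (128 * B ^ 2 + B) + 1) * (ε / 4) := by positivity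
    have e2 : x - (x - ε / 4) = ε / 4 := by ring
    rw [e2, add_mul, e1]
    linarith

lemma P_pos_of_alpha_eq_one (h : 0 < c.1 ∧ 0 < c.2.1 ∧ c3star c.1 c.2.1 < c.2.2) :
    ∀ x ∈ Icc (-1 : ℝ) 1, 0 < P c x := fun _ hx => P_pos h.1 h.2.1 h.2.2 hx

lemma alpha_pos (c : ℝ × ℝ × ℝ) : 0 < alpha c := by
  unfold alpha; split_ifs <;> norm_num

lemma alpha_le_one (c : ℝ × ℝ × ℝ) : alpha c ≤ 1 := by
  unfold alpha; split_ifs <;> norm_num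

/-- The error `U²/2 - P_c` is of order `ν^α`. -/
lemma exists_error_le (c : ℝ × ℝ × ℝ) {ε : ℝ} (hε : 0 < ε) :
    ∃ C > 0, ∀ᶠ d in admFilter c, ∀ x ∈ Ioo (d.left + ε) 1,
      (0 < d.sol x ∧ d.sol x ≤ 8 * (bound c + 1)) ∧
        |d.sol x ^ 2 / 2 - P d.par x| ≤ C * d.nu ^ alpha c := by
  obtain ⟨C, hC, hCe⟩ := exists_error_le_two_thirds c hε
  by_cases h : 0 < c.1 ∧ 0 < c.2.1 ∧ c3star c.1 c.2.1 < c.2.2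
  · obtain ⟨C', hC', hCe'⟩ := exists_error_le_linear (P_pos_of_alpha_eq_one h) hε
    refine ⟨C', hC', ?_⟩
    have ha : alpha c = 1 := by unfold alpha; rw [if_pos h]
    filter_upwards [hCe, hCe'] with d h1 h2 x hx
    exact ⟨(h1 x hx).1, by rw [ha, Real.rpow_one]; exact h2 x hx⟩
  -- Here `α ≤ 2/3` and `ν < 1`, so `ν^(2/3) ≤ ν^α`; the case `α = 1/2` needs no separate argument.
  · refine ⟨C, hC, ?_⟩
    have ha : alpha c ≤ 2 / 3 := by
      unfold alpha; rw [if_neg h]; split_ifs <;> norm_num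
    filter_upwards [hCe, eventually_admissible c, eventually_nu_lt c one_pos] with d h1 hd hν x hx
    refine ⟨(h1 x hx).1, (h1 x hx).2.trans ?_⟩
    exact mul_le_mul_of_nonneg_left (Real.rpow_le_rpow_of_exponent_ge hd.nu_pos hν.le ha) hC.le

/-! ### Families with uniformly bounded derivatives -/

/-- Families `f` of smooth functions on `(left, 1)` that are eventually bounded on
`(left + ε, 1 - ε)`. -/
def CB₀ (c : ℝ × ℝ × ℝ) (f : Datum → ℝ → ℝ) : Prop :=
  (∀ᶠ d in admFilter c, ContDiffOn ℝ ((⊤ : ℕ∞) : WithTop ℕ∞) (f d) (Ioo d.left 1)) ∧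
    ∀ ε > 0, ∃ C : ℝ, ∀ᶠ d in admFilter c, ∀ x ∈ Ioo (d.left + ε) (1 - ε), |f d x| ≤ C

/-- Families `f` of smooth functions on `(left, 1)` whose derivatives up to order `n` are eventually
bounded on `(left + ε, 1 - ε)`. -/
def CB (c : ℝ × ℝ × ℝ) (n : ℕ) : (Datum → ℝ → ℝ) → Prop :=
  Nat.rec (CB₀ c) (fun _ ih f => CB₀ c f ∧ ih fun d => deriv (f d)) n

lemma mem_Ioo_left {l ε x : ℝ} (hε : 0 < ε) (hx : x ∈ Ioo (l + ε) (1 - ε)) : x ∈ Ioo l 1 :=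
  ⟨by linarith [hx.1], by linarith [hx.2]⟩

lemma Datum.Admissible.mem {d : Datum} (hd : d.Admissible) {x : ℝ} (hx : x ∈ Ioo d.left 1) :
    x ∈ Ioo (-1 : ℝ) 1 := ⟨hd.left_ge.trans_lt hx.1, hx.2⟩

namespace CB

variable {n : ℕ} {f g : Datum → ℝ → ℝ}

lemma zero (h : CB c n f) : CB₀ c f := by
  cases n with
  | zero => exact h
  | succ n => exact h.1

lemma deriv_mem (h : CB c (n + 1) f) : CB c n (fun d => deriv (f d)) := h.2

lemma smooth (h : CB c n f) :
    ∀ᶠ d in admFilter c, ContDiffOn ℝ ((⊤ : ℕ∞) : WithTop ℕ∞) (f d) (Ioo d.left 1) := h.zero.1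

lemma of_succ (h : CB c (n + 1) f) : CB c n f := by
  induction n generalizing f with
  | zero => exact h.1
  | succ n ih => exact ⟨h.1, ih h.2⟩

lemma congr (h : CB c n f) (hfg : ∀ᶠ d in admFilter c, EqOn (g d) (f d) (Ioo d.left 1)) :
    CB c n g := by
  have h0 : ∀ {f g : Datum → ℝ → ℝ}, CB₀ c f →
      (∀ᶠ d in admFilter c, EqOn (g d) (f d) (Ioo d.left 1)) → CB₀ c g := by
    intro f g h hfg
    refine ⟨?_, fun ε hε => ?_⟩
    · filter_upwards [h.1, hfg] with d h1 h2
      exact h1.congr h2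
    · obtain ⟨C, hC⟩ := h.2 ε hε
      refine ⟨C, ?_⟩
      filter_upwards [hC, hfg] with d h1 h2 x hx
      rw [h2 (mem_Ioo_left hε hx)]
      exact h1 x hx
  induction n generalizing f g with
  | zero => exact h0 h hfg
  | succ n ih => exact ⟨h0 h.1 hfg, ih h.2 (hfg.mono fun d hd => hd.deriv isOpen_Ioo)⟩

lemma hasDerivAt (h : CB c n f) :
    ∀ᶠ d in admFilter c, ∀ x ∈ Ioo d.left 1, HasDerivAt (f d) (deriv (f d) x) x := by
  filter_upwards [h.smooth] with d hd x hx
  exact ((hd.differentiableOn (by simp)).differentiableAt (isOpen_Ioo.mem_nhds hx)).hasDerivAt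

lemma const {h : Datum → ℝ} {C : ℝ} (hC : ∀ᶠ d in admFilter c, |h d| ≤ C) :
    CB c n (fun d _ => h d) := by
  induction n generalizing h C with
  | zero =>
    exact ⟨Eventually.of_forall fun _ => contDiffOn_const,
      fun ε _ => ⟨C, hC.mono fun d hd _ _ => hd⟩⟩
  | succ n ih =>
    refine ⟨⟨Eventually.of_forall fun _ => contDiffOn_const,
      fun ε _ => ⟨C, hC.mono fun d hd _ _ => hd⟩⟩, ?_⟩
    simp only [deriv_const']
    exact ih (h := fun _ => 0) (C := 0) (by simp)

lemma id : CB c n (fun _ x => x) := by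
  have h0 : CB₀ c (fun _ x => x) := by
    refine ⟨Eventually.of_forall fun _ => contDiffOn_id, fun ε hε => ⟨1, ?_⟩⟩
    filter_upwards [eventually_admissible c] with d hd x hx
    have := hd.mem (mem_Ioo_left hε hx)
    exact abs_le.2 ⟨this.1.le, this.2.le⟩
  cases n with
  | zero => exact h0
  | succ n =>
    refine ⟨h0, ?_⟩
    simp only [deriv_id'']
    exact const (h := fun _ => 1) (C := 1) (by simp)

lemma add (hf : CB c n f) (hg : CB c n g) : CB c n (fun d x => f d x + g d x) := by
  have h0 : ∀ {f g : Datum → ℝ → ℝ}, CB₀ c f → CB₀ c g →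
      CB₀ c (fun d x => f d x + g d x) := by
    intro f g hf hg
    refine ⟨?_, fun ε hε => ?_⟩
    · filter_upwards [hf.1, hg.1] with d h1 h2
      exact h1.add h2
    · obtain ⟨C, hC⟩ := hf.2 ε hε
      obtain ⟨C', hC'⟩ := hg.2 ε hε
      refine ⟨C + C', ?_⟩
      filter_upwards [hC, hC'] with d h1 h2 x hx
      exact (abs_add_le _ _).trans (add_le_add (h1 x hx) (h2 x hx))
  induction n generalizing f g with
  | zero => exact h0 hf hg
  | succ n ih =>
    refine ⟨h0 hf.1 hg.1, (ih hf.2 hg.2).congr ?_⟩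
    filter_upwards [hf.hasDerivAt, hg.hasDerivAt] with d h1 h2 x hx
    exact ((h1 x hx).add (h2 x hx)).deriv

lemma mul (hf : CB c n f) (hg : CB c n g) : CB c n (fun d x => f d x * g d x) := by
  have h0 : ∀ {f g : Datum → ℝ → ℝ}, CB₀ c f → CB₀ c g →
      CB₀ c (fun d x => f d x * g d x) := by
    intro f g hf hg
    refine ⟨?_, fun ε hε => ?_⟩
    · filter_upwards [hf.1, hg.1] with d h1 h2
      exact h1.mul h2
    · obtain ⟨C, hC⟩ := hf.2 ε hε
      obtain ⟨C', hC'⟩ := hg.2 ε hε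
      refine ⟨C * C', ?_⟩
      filter_upwards [hC, hC'] with d h1 h2 x hx
      rw [abs_mul]
      exact mul_le_mul (h1 x hx) (h2 x hx) (abs_nonneg _) ((abs_nonneg _).trans (h1 x hx))
  induction n generalizing f g with
  | zero => exact h0 hf hg
  | succ n ih =>
    refine ⟨h0 hf.1 hg.1, ((ih hf.2 hg.of_succ).add (ih hf.of_succ hg.2)).congr ?_⟩
    filter_upwards [hf.hasDerivAt, hg.hasDerivAt] with d h1 h2 x hx
    exact ((h1 x hx).mul (h2 x hx)).deriv

lemma const_mul (r : ℝ) (hf : CB c n f) : CB c n (fun d x => r * f d x) :=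
  (const (h := fun _ => r) (C := |r|) (by simp)).mul hf

lemma neg (hf : CB c n f) : CB c n (fun d x => -f d x) := by
  simpa using hf.const_mul (-1)

lemma sub (hf : CB c n f) (hg : CB c n g) : CB c n (fun d x => f d x - g d x) := by
  simpa only [sub_eq_add_neg] using hf.add hg.neg

lemma nu_mul (hf : CB c n f) : CB c n (fun d x => d.nu * f d x) := by
  refine (const (h := Datum.nu) (C := 1) ?_).mul hf
  filter_upwards [eventually_admissible c, eventually_nu_lt c one_pos] with d hd h1
  rw [abs_of_pos hd.nu_pos]
  exact h1.le

/-- Induction on the order: `(1/f)' = -f' · (1/f)²` involves derivatives of `1/f` of lower order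
only. -/
lemma inv (hf : CB c n f) (h0 : ∀ᶠ d in admFilter c, ∀ x ∈ Ioo d.left 1, f d x ≠ 0)
    (hlow : ∀ ε > 0, ∃ m > 0, ∀ᶠ d in admFilter c, ∀ x ∈ Ioo (d.left + ε) (1 - ε), m ≤ |f d x|) :
    CB c n (fun d x => (f d x)⁻¹) := by
  have hz : CB₀ c (fun d x => (f d x)⁻¹) := by
    refine ⟨?_, fun ε hε => ?_⟩
    · filter_upwards [hf.smooth, h0] with d h1 h2
      exact h1.inv h2
    · obtain ⟨m, hm, hme⟩ := hlow ε hε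
      refine ⟨m⁻¹, ?_⟩
      filter_upwards [hme] with d h1 x hx
      rw [abs_inv]
      exact inv_anti₀ hm (h1 x hx)
  induction n with
  | zero => exact hz
  | succ n ih =>
    have hi := ih hf.of_succ
    refine ⟨hz, ((hf.deriv_mem.mul (hi.mul hi)).neg).congr ?_⟩
    filter_upwards [hf.hasDerivAt, h0] with d h1 h2 x hx
    rw [((h1 x hx).fun_inv (h2 x hx)).deriv]
    field_simp

lemma iteratedDeriv_le (hf : CB c n f) {ε : ℝ} (hε : 0 < ε) :
    ∃ C : ℝ, ∀ᶠ d in admFilter c, ∀ x ∈ Ioo (d.left + ε) (1 - ε), ∀ j ≤ n,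
      |iteratedDeriv j (f d) x| ≤ C := by
  induction n generalizing f with
  | zero =>
    obtain ⟨C, hC⟩ := hf.2 ε hε
    refine ⟨C, hC.mono fun d hd x hx j hj => ?_⟩
    obtain rfl := Nat.le_zero.1 hj
    rw [iteratedDeriv_zero]
    exact hd x hx
  | succ n ih =>
    obtain ⟨C, hC⟩ := hf.1.2 ε hε
    obtain ⟨C', hC'⟩ := ih hf.2
    refine ⟨max C C', ?_⟩
    filter_upwards [hC, hC'] with d h1 h2 x hx j hj
    cases j with
    | zero =>
      rw [iteratedDeriv_zero]
      exact (h1 x hx).trans (le_max_left _ _)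
    | succ j =>
      rw [iteratedDeriv_succ']
      exact (h2 x hx j (by omega)).trans (le_max_right _ _)

lemma one_sub_sq : CB c n (fun _ x => 1 - x ^ 2) := by
  refine ((const (h := fun _ => 1) (C := 1) (by simp)).sub (CB.id.mul CB.id)).congr ?_
  exact Eventually.of_forall fun d x _ => by simp [sq]

lemma inv_one_sub_sq : CB c n (fun _ x => (1 - x ^ 2)⁻¹) := by
  refine one_sub_sq.inv ?_ fun ε hε => ⟨ε ^ 2, by positivity, ?_⟩
  · filter_upwards [eventually_admissible c] with d hd x hx
    exact (one_sub_sq_pos (hd.mem hx)).ne'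
  · filter_upwards [eventually_admissible c] with d hd x hx
    have h1 : ε ≤ 1 - x := by linarith [hx.2]
    have h2 : ε ≤ 1 + x := by linarith [hx.1, hd.left_ge]
    refine le_trans ?_ (le_abs_self _)
    nlinarith

/-- Bounds for singularly perturbed linear equations of first order. -/
lemma of_linear {y b g : Datum → ℝ → ℝ} {b₀ : ℝ} (hb₀ : 0 < b₀) (hb : CB c n b) (hg : CB c n g)
    (hlow : ∀ᶠ d in admFilter c, ∀ x ∈ Ioo d.left 1, b₀ ≤ b d x)
    (hy : ∀ᶠ d in admFilter c, ContDiffOn ℝ ((⊤ : ℕ∞) : WithTop ℕ∞) (y d) (Ioo d.left 1))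
    (hνy : CB₀ c (fun d x => d.nu * y d x))
    (heq : ∀ᶠ d in admFilter c, ∀ x ∈ Ioo d.left 1,
      d.nu * (1 - x ^ 2) * deriv (y d) x + b d x * y d x = g d x) : CB c n y := by
  have h0 : ∀ {y b g : Datum → ℝ → ℝ} {b₀ : ℝ}, 0 < b₀ → CB₀ c b → CB₀ c g →
      (∀ᶠ d in admFilter c, ∀ x ∈ Ioo d.left 1, b₀ ≤ b d x) →
      (∀ᶠ d in admFilter c, ContDiffOn ℝ ((⊤ : ℕ∞) : WithTop ℕ∞) (y d) (Ioo d.left 1)) →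
      CB₀ c (fun d x => d.nu * y d x) →
      (∀ᶠ d in admFilter c, ∀ x ∈ Ioo d.left 1,
        d.nu * (1 - x ^ 2) * deriv (y d) x + b d x * y d x = g d x) → CB₀ c y := by
    intro y b g b₀ hb₀ hb hg hlow hy hνy heq
    refine ⟨hy, fun ε hε => ?_⟩
    obtain ⟨M, hM⟩ := hg.2 (ε / 2) (half_pos hε)
    obtain ⟨E, hE⟩ := hνy.2 (ε / 2) (half_pos hε)
    -- The first two summands dominate the source; the last, over a length `ε/4`, absorbs the
    -- starting value, known only through `ν|y| ≤ |E|`.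
    refine ⟨(2 * |M| + 1 + 8 * |E| / ε) / b₀, ?_⟩
    filter_upwards [eventually_admissible c, hM, hE, hlow, hy, heq] with d hd h1 h2 h3 h4 h5 x hx
    have hI : ∀ z ∈ Icc (x - ε / 4) x, z ∈ Ioo (d.left + ε / 2) (1 - ε / 2) := fun z hz =>
      ⟨by linarith [hx.1, hz.1], by linarith [hx.2, hz.2]⟩
    have hJ : ∀ z ∈ Icc (x - ε / 4) x, z ∈ Ioo d.left 1 := fun z hz =>
      mem_Ioo_left (half_pos hε) (hI z hz)
    have hY : b₀ * ((2 * |M| + 1 + 8 * |E| / ε) / b₀) = 2 * |M| + 1 + 8 * |E| / ε := by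
      field_simp
    have hxx : x - ε / 4 ∈ Icc (x - ε / 4) x := ⟨le_rfl, by linarith⟩
    refine abs_le_of_linear_decay (x₀ := x - ε / 4) (a := fun x => 1 - x ^ 2) (M := |M|) hd.nu_pos
      (by linarith) ?_ ?_ hb₀ (fun z hz => h3 z (hJ z hz))
      (fun z hz => (h1 z (hI z hz)).trans (le_abs_self M)) ?_ ?_
    · intro z hz
      have ha := one_sub_sq_pos (hd.mem (hJ z hz))
      have := ((h4.differentiableOn (by simp)).differentiableAt
        (isOpen_Ioo.mem_nhds (hJ z hz))).hasDerivAt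
      refine this.congr_deriv ?_
      rw [eq_div_iff (mul_pos hd.nu_pos ha).ne', ← h5 z (hJ z hz)]
      ring
    · intro z hz
      exact ⟨one_sub_sq_pos (hd.mem (hJ z hz)), by nlinarith [sq_nonneg z]⟩
    · rw [hY]
      have : 0 ≤ 8 * |E| / ε := by positivity
      linarith
    · rw [hY]
      have e0 := (h2 _ (hI _ hxx)).trans (le_abs_self E)
      rw [abs_mul, abs_of_pos hd.nu_pos] at e0
      have e1 : 8 * |E| / ε * (ε / 4) = 2 * |E| := by field_simp; ring
      have : 0 ≤ (2 * |M| + 1) * (ε / 4) := by positivity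
      have e2 : x - (x - ε / 4) = ε / 4 := by ring
      rw [e2, add_mul, e1]
      linarith
  induction n generalizing y b g b₀ with
  | zero => exact h0 hb₀ hb hg hlow hy hνy heq
  | succ n ih =>
    have hyn : CB c n y := ih hb₀ hb.of_succ hg.of_succ hlow hy hνy heq
    -- Differentiating the equation gives one of the same form for `y'`, with damping `b - 2νx ≥
    -- b₀/2` for small `ν` and source `g' - b'y`. The a priori bound on `νy'` is read off from the
    -- undifferentiated equation.
    refine ⟨hyn.zero, ih (b := fun d x => b d x - 2 * (d.nu * x))
      (g := fun d x => deriv (g d) x - deriv (b d) x * y d x) (half_pos hb₀)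
      (hb.of_succ.sub (CB.id.nu_mul.const_mul 2)) (hg.deriv_mem.sub (hb.deriv_mem.mul hyn)) ?_ ?_ ?_ ?_⟩
    · filter_upwards [eventually_admissible c, hlow,
        eventually_nu_lt c (show 0 < b₀ / 4 by positivity)] with d hd h1 h2 x hx
      have := h1 x hx
      have : d.nu * x ≤ d.nu * 1 := by
        have := hd.nu_pos
        have := hx.2
        gcongr
      linarith
    · filter_upwards [hy] with d h1
      exact ((contDiffOn_infty_iff_deriv_of_isOpen isOpen_Ioo).1 h1).2
    · refine CB.congr (n := 0) ((CB.sub (n := 0) hg.zero (CB.mul (n := 0) hb.zero hyn.zero)).mul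
        inv_one_sub_sq) ?_
      filter_upwards [eventually_admissible c, heq] with d hd h1 x hx
      have ha := one_sub_sq_pos (hd.mem hx)
      have := h1 x hx
      field_simp
      linarith
    · filter_upwards [heq, hy, hb.hasDerivAt, hg.hasDerivAt] with d h1 h2 h3 h4 x hx
      have hy1 := ((h2.differentiableOn (by simp)).differentiableAt
        (isOpen_Ioo.mem_nhds hx)).hasDerivAt
      have h2' := ((contDiffOn_infty_iff_deriv_of_isOpen isOpen_Ioo).1 h2).2
      have hy2 := ((h2'.differentiableOn (by simp)).differentiableAt
        (isOpen_Ioo.mem_nhds hx)).hasDerivAt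
      have e : (fun x => d.nu * (1 - x ^ 2) * deriv (y d) x + b d x * y d x) =ᶠ[𝓝 x] g d := by
        filter_upwards [isOpen_Ioo.mem_nhds hx] with z hz using h1 z hz
      have hL := ((((hasDerivAt_pow 2 x).const_sub 1).const_mul d.nu).mul hy2).add
        ((h3 x hx).mul hy1)
      have := (hL.congr_of_eventuallyEq e.symm).unique (h4 x hx)
      push_cast at this
      linear_combination this

end CB

/-! ### Smoothness of solutions and the expansion around the profile `√(2P)`. -/

lemma contDiff_P (c : ℝ × ℝ × ℝ) {n : WithTop ℕ∞} : ContDiff ℝ n (P c) := by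
  unfold P; fun_prop

/-- Bootstrap: the equation expresses `U'` smoothly through `U` and `x`. -/
lemma IsSolution.contDiffOn {ν : ℝ} {c : ℝ × ℝ × ℝ} {U : ℝ → ℝ} (h : IsSolution ν c U)
    (hν : 0 < ν) : ContDiffOn ℝ ((⊤ : ℕ∞) : WithTop ℕ∞) U (Ioo (-1) 1) := by
  refine contDiffOn_infty.2 fun n => ?_
  induction n with
  | zero => exact contDiffOn_zero.2 h.1.continuousOn
  | succ n ih =>
    push_cast
    refine (contDiffOn_succ_iff_deriv_of_isOpen isOpen_Ioo).2 ⟨fun x hx =>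
      (h.hasDerivAt hν hx).differentiableAt.differentiableWithinAt, by simp, ?_⟩
    have h1 : ContDiffOn ℝ n
        (fun x => (P c x - U x ^ 2 / 2 - 2 * ν * x * U x) / (ν * (1 - x ^ 2))) (Ioo (-1) 1) := by
      refine ContDiffOn.div ?_ (by fun_prop) fun x hx => ?_
      · refine ((contDiff_P c).contDiffOn.sub ((ih.pow 2).div_const 2)).sub (ContDiffOn.mul ?_ ih)
        fun_prop
      · exact (mul_pos hν (one_sub_sq_pos hx)).ne'
    exact h1.congr fun x hx => (h.hasDerivAt hν hx).deriv

/-- The limit profile `√(2P)`. -/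
def profile (c : ℝ × ℝ × ℝ) (x : ℝ) : ℝ := √(2 * P c x)

lemma profile_sq {c : ℝ × ℝ × ℝ} {x : ℝ} (h : 0 ≤ P c x) : profile c x ^ 2 = 2 * P c x :=
  Real.sq_sqrt (by linarith)

lemma profile_nonneg (c : ℝ × ℝ × ℝ) (x : ℝ) : 0 ≤ profile c x := Real.sqrt_nonneg _

lemma hasDerivAt_profile {c : ℝ × ℝ × ℝ} {x : ℝ} (h : 0 < P c x) :
    HasDerivAt (profile c) (dP c x * (profile c x)⁻¹) x := by
  have h0 : 0 < profile c x := Real.sqrt_pos.2 (by linarith)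
  refine (((hasDerivAt_P c x).const_mul 2).sqrt (by linarith)).congr_deriv ?_
  change 2 * dP c x / (2 * profile c x) = _
  field_simp

lemma exists_pos_le_profile (hP : ∀ x ∈ Icc (-1 : ℝ) 1, 0 < P c x) :
    ∃ δ > 0, ∀ᶠ c' in 𝓝 c, ∀ x ∈ Icc (-1 : ℝ) 1, 0 < P c' x ∧ δ ≤ profile c' x := by
  obtain ⟨δ, hδ, h⟩ := exists_pos_le_P hP
  refine ⟨√(2 * δ), Real.sqrt_pos.2 (by linarith), h.mono fun c' hc' x hx => ?_⟩
  exact ⟨hδ.trans_le (hc' x hx), Real.sqrt_le_sqrt (by linarith [hc' x hx])⟩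

/-- Convergence of order `ν` to the profile when `P_c` is positive on `[-1, 1]`. -/
lemma exists_sub_profile_le (hP : ∀ x ∈ Icc (-1 : ℝ) 1, 0 < P c x) {ε : ℝ} (hε : 0 < ε) :
    ∃ C > 0, ∀ᶠ d in admFilter c, ∀ x ∈ Ioo (d.left + ε) 1,
      |d.sol x - profile d.par x| ≤ C * d.nu := by
  obtain ⟨C, hC, h⟩ := exists_error_le_linear hP hε
  obtain ⟨δ, hδ, hq⟩ := exists_pos_le_profile hP
  refine ⟨2 * C / δ, by positivity, ?_⟩
  filter_upwards [h, (tendsto_par c).eventually hq, eventually_admissible c] with d h1 h2 hd x hx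
  have hx' : x ∈ Ioo d.left 1 := ⟨by linarith [hx.1], hx.2⟩
  obtain ⟨h3, h4⟩ := h2 x (Ioo_subset_Icc_self (hd.mem hx'))
  have h5 := hd.pos x hx'
  have h6 := h1 x hx
  have e : d.sol x ^ 2 / 2 - P d.par x =
      (d.sol x - profile d.par x) * (d.sol x + profile d.par x) / 2 := by
    have := profile_sq h3.le
    linear_combination (1 / 2) * this
  rw [e, abs_div, abs_mul, abs_of_pos (show 0 < d.sol x + profile d.par x by linarith),
    abs_two] at h6
  have h7 : |d.sol x - profile d.par x| * δ ≤
      |d.sol x - profile d.par x| * (d.sol x + profile d.par x) := by gcongr; linarith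
  rw [div_mul_eq_mul_div, le_div_iff₀ hδ]
  linarith

namespace CB

variable {n : ℕ}

lemma dP_par : CB c n (fun d x => dP d.par x) := by
  have h1 : ∀ᶠ d in admFilter c, |-d.par.1 + d.par.2.1| ≤ bound c + 1 := by
    filter_upwards [eventually_bound_le c] with d hd
    refine (abs_add_le _ _).trans (le_trans ?_ hd)
    rw [abs_neg, bound]
    linarith [abs_nonneg d.par.1, abs_nonneg d.par.2.1, abs_nonneg d.par.2.2]
  have h2 : ∀ᶠ d in admFilter c, |2 * d.par.2.2| ≤ bound c + 1 := by
    filter_upwards [eventually_bound_le c] with d hd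
    refine le_trans ?_ hd
    rw [abs_mul, abs_two, bound]
    linarith [abs_nonneg d.par.1, abs_nonneg d.par.2.1]
  exact (const (h := fun d => -d.par.1 + d.par.2.1) h1).sub
    ((const (h := fun d => 2 * d.par.2.2) h2).mul CB.id)

lemma profile_par (hP : ∀ x ∈ Icc (-1 : ℝ) 1, 0 < P c x) :
    CB c n (fun d x => profile d.par x) := by
  obtain ⟨δ, hδ, hq⟩ := exists_pos_le_profile hP
  have hq' : ∀ᶠ d in admFilter c, ∀ x ∈ Ioo d.left 1, 0 < P d.par x ∧ δ ≤ profile d.par x := by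
    filter_upwards [(tendsto_par c).eventually hq, eventually_admissible c] with d h1 hd x hx
    exact h1 x (Ioo_subset_Icc_self (hd.mem hx))
  have h0 : CB₀ c (fun d x => profile d.par x) := by
    refine ⟨?_, fun ε hε => ⟨√(2 * (bound c + 1)), ?_⟩⟩
    · filter_upwards [hq'] with d hd
      exact ((contDiff_P d.par).contDiffOn.const_smul (2 : ℝ)).sqrt fun x hx => by
        have := (hd x hx).1
        simp only [smul_eq_mul]
        positivity
    · filter_upwards [eventually_bound_le c, eventually_admissible c] with d h1 hd x hx
      have h2 := abs_P_le d.par (Ioo_subset_Icc_self (hd.mem (mem_Ioo_left hε hx)))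
      rw [abs_of_nonneg (profile_nonneg _ _)]
      refine Real.sqrt_le_sqrt ?_
      linarith [le_abs_self (P d.par x)]
  induction n with
  | zero => exact h0
  | succ n ih =>
    have hi := ih.inv (hq'.mono fun d hd x hx => (hδ.trans_le (hd x hx).2).ne')
      (fun ε hε => ⟨δ, hδ, hq'.mono fun d hd x hx =>
        ((hd x (mem_Ioo_left hε hx)).2).trans (le_abs_self _)⟩)
    refine ⟨h0, (dP_par.mul hi).congr ?_⟩
    filter_upwards [hq'] with d hd x hx
    exact (hasDerivAt_profile (hd x hx).1).deriv

/-- The scaled difference between solution and profile has bounded derivatives. -/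
lemma scaled_sub_profile (hP : ∀ x ∈ Icc (-1 : ℝ) 1, 0 < P c x) :
    CB c n (fun d x => (d.sol x - profile d.par x) / d.nu) := by
  obtain ⟨δ, hδ, hq⟩ := exists_pos_le_profile hP
  have hq' : ∀ᶠ d in admFilter c, ∀ x ∈ Ioo d.left 1, 0 < P d.par x ∧ δ ≤ profile d.par x := by
    filter_upwards [(tendsto_par c).eventually hq, eventually_admissible c] with d h1 hd x hx
    exact h1 x (Ioo_subset_Icc_self (hd.mem hx))
  set Z : Datum → ℝ → ℝ := fun d x => (d.sol x - profile d.par x) / d.nu with hZ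
  -- Substituting `U = q + νZ`, with `q` the profile, and dividing by `ν` gives `ν(1-x²)Z' + bZ =
  -- -((1-x²)q' + 2xq)`. The quadratic term is hidden in `b`, which equals `(U+q)/2 + 2νx` and is
  -- thus bounded below.
  set b : Datum → ℝ → ℝ := fun d x =>
    profile d.par x + 2 * (d.nu * x) + (1 / 2) * (d.nu * Z d x) with hb
  have hg : ∀ {n}, CB c n (fun d x => -((1 - x ^ 2) * (dP d.par x * (profile d.par x)⁻¹) +
      2 * (x * profile d.par x))) := by
    intro n
    have hi := (profile_par (n := n) hP).inv
      (hq'.mono fun d hd x hx => (hδ.trans_le (hd x hx).2).ne')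
      (fun ε hε => ⟨δ, hδ, hq'.mono fun d hd x hx =>
        ((hd x (mem_Ioo_left hε hx)).2).trans (le_abs_self _)⟩)
    exact ((one_sub_sq.mul (dP_par.mul hi)).add
      ((CB.id.mul (profile_par hP)).const_mul 2)).neg
  have hbZ : ∀ {n}, CB c n (fun d x => d.nu * Z d x) → CB c n b := fun h =>
    ((profile_par hP).add (CB.id.nu_mul.const_mul 2)).add (h.const_mul (1 / 2))
  have hZ0 : CB₀ c Z := by
    refine ⟨?_, fun ε hε => ?_⟩
    · filter_upwards [eventually_admissible c, (profile_par (n := 0) hP).smooth] with d hd h1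
      exact (((hd.solution.contDiffOn hd.nu_pos).mono
        (fun x hx => hd.mem hx)).sub h1).div_const d.nu
    · obtain ⟨C, _, hC⟩ := exists_sub_profile_le hP hε
      refine ⟨C, ?_⟩
      filter_upwards [hC, eventually_admissible c] with d h1 hd x hx
      rw [hZ, abs_div, abs_of_pos hd.nu_pos, div_le_iff₀ hd.nu_pos]
      exact h1 x ⟨hx.1, by linarith [hx.2]⟩
  have heq : ∀ᶠ d in admFilter c, ∀ x ∈ Ioo d.left 1,
      d.nu * (1 - x ^ 2) * deriv (Z d) x + b d x * Z d x =
        -((1 - x ^ 2) * (dP d.par x * (profile d.par x)⁻¹) + 2 * (x * profile d.par x)) := by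
    filter_upwards [eventually_admissible c, hq'] with d hd h1 x hx
    have hν := hd.nu_pos
    obtain ⟨h2, h3⟩ := h1 x hx
    have hUd := hd.solution.hasDerivAt hν (hd.mem hx)
    have hZd := (hUd.sub (hasDerivAt_profile h2)).div_const d.nu
    have e : deriv (Z d) x = _ := hZd.deriv
    have ha := one_sub_sq_pos (hd.mem hx)
    have hsq := profile_sq h2.le
    have hPe : P d.par x = profile d.par x ^ 2 / 2 := by linarith
    rw [e]
    simp only [hb, hZ, hPe]
    have : profile d.par x ≠ 0 := (hδ.trans_le h3).ne'
    field_simp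
    ring
  have hlow : ∀ᶠ d in admFilter c, ∀ x ∈ Ioo d.left 1, δ / 4 ≤ b d x := by
    filter_upwards [eventually_admissible c, hq',
      eventually_nu_lt c (show 0 < δ / 8 by positivity)] with d hd h1 h2 x hx
    have hν := hd.nu_pos
    have e : b d x = (d.sol x + profile d.par x) / 2 + 2 * (d.nu * x) := by
      simp only [hb, hZ]; field_simp; ring
    have h3 : d.nu * (-1) ≤ d.nu * x := by gcongr; exact (hd.mem hx).1.le
    rw [e]
    linarith [hd.pos x hx, (h1 x hx).2]
  change CB c n Z
  induction n with
  | zero => exact hZ0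
  | succ n ih =>
    -- The coefficient `b` contains `νZ`, so its regularity must be secured first. The equation
    -- writes `ν(1-x²)Z'` through `Z` and `b`, so `νZ` is controlled to one order more than `Z`.
    have hνZ : CB c (n + 1) (fun d x => d.nu * Z d x) := by
      refine ⟨CB.nu_mul (n := 0) hZ0, ((hg.sub ((hbZ ih.nu_mul).mul ih)).mul
        inv_one_sub_sq).congr ?_⟩
      filter_upwards [heq, eventually_admissible c, ih.hasDerivAt] with d h1 hd h2 x hx
      have ha := one_sub_sq_pos (hd.mem hx)
      rw [((h2 x hx).const_mul d.nu).deriv]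
      beta_reduce
      rw [← h1 x hx]
      field_simp
      ring
    exact of_linear (by positivity) (hbZ hνZ) hg hlow hZ0.1 hνZ.zero heq

end CB

/-- Convergence of order `ν` to the profile together with all derivatives, when `P_c` is positive on
`[-1, 1]`. -/
lemma exists_iteratedDeriv_sub_profile_le (hP : ∀ x ∈ Icc (-1 : ℝ) 1, 0 < P c x) {ε : ℝ}
    (hε : 0 < ε) (m : ℕ) : ∃ C > 0, ∀ᶠ d in admFilter c,
      ContDiffOn ℝ m (fun x => d.sol x - profile d.par x) (Ioo d.left 1) ∧
      ∀ x ∈ Ioo (d.left + ε) (1 - ε), ∀ j ≤ m,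
        |iteratedDeriv j (fun x => d.sol x - profile d.par x) x| ≤ C * d.nu := by
  have h := CB.scaled_sub_profile (n := m) hP
  obtain ⟨C, hC⟩ := h.iteratedDeriv_le hε
  refine ⟨|C| + 1, by positivity, ?_⟩
  filter_upwards [h.smooth, hC, eventually_admissible c] with d h1 h2 hd
  have e : (fun x => d.sol x - profile d.par x) =
      fun x => d.nu * ((d.sol x - profile d.par x) / d.nu) := by
    ext x
    rw [mul_div_cancel₀ _ hd.nu_pos.ne']
  refine ⟨?_, fun x hx j hj => ?_⟩
  · rw [e]
    exact contDiffOn_const.mul (h1.of_le (by exact_mod_cast le_top))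
  · rw [e, iteratedDeriv_const_mul_field, abs_mul, abs_of_pos hd.nu_pos, mul_comm]
    gcongr
    · exact hd.nu_pos.le
    · exact (h2 x hx j hj).trans (by linarith [le_abs_self C])

/-! ### Norms -/

lemma linftyNorm_le {s : Set ℝ} (hs : MeasurableSet s) {f : ℝ → ℝ} {b : ℝ}
    (h : ∀ x ∈ s, |f x| ≤ b) : linftyNorm s f ≤ ENNReal.ofReal b := by
  rw [linftyNorm, eLpNorm_exponent_top]
  exact eLpNormEssSup_le_of_ae_bound (ae_restrict_of_forall_mem hs h)

lemma iSup_enorm_le {s : Set ℝ} {f : ℝ → ℝ} {b : ℝ} (h : ∀ x ∈ s, |f x| ≤ b) :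
    ⨆ x ∈ s, ‖f x‖ₑ ≤ ENNReal.ofReal b := by
  refine iSup₂_le fun x hx => ?_
  rw [Real.enorm_eq_ofReal_abs]
  exact ENNReal.ofReal_le_ofReal (h x hx)

lemma holderNorm_le {β : ℝ≥0} {s : Set ℝ} {f : ℝ → ℝ} {b L : ℝ} (hL : 0 ≤ L)
    (h : ∀ x ∈ s, |f x| ≤ b) (hf : ∀ x ∈ s, ∀ y ∈ s, |f x - f y| ≤ L * |x - y| ^ (β : ℝ)) :
    holderNorm β s f ≤ ENNReal.ofReal b + ENNReal.ofReal L := by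
  refine add_le_add (iSup_enorm_le h) ?_
  have : HolderWith L.toNNReal β (fun x : s => f x) := fun x y => by
    have h1 := hf x x.2 y y.2
    rw [edist_dist, edist_dist, Subtype.dist_eq, Real.dist_eq, Real.dist_eq,
      ENNReal.ofReal_rpow_of_nonneg (abs_nonneg _) β.coe_nonneg]
    refine (ENNReal.ofReal_le_ofReal h1).trans ?_
    rw [ENNReal.ofReal_mul hL]
    rfl
  exact this.eHolderNorm_le

lemma cmNorm_le {m : ℕ} {s : Set ℝ} {f : ℝ → ℝ} {b : ℝ} (hf : ContDiffOn ℝ m f s)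
    (h : ∀ x ∈ s, ∀ j ≤ m, |iteratedDeriv j f x| ≤ b) :
    cmNorm m s f ≤ ENNReal.ofReal ((m + 1) * b) := by
  rw [cmNorm, if_pos hf]
  calc ∑ j ∈ Finset.range (m + 1), ⨆ x ∈ s, ‖iteratedDeriv j f x‖ₑ
      ≤ ∑ _j ∈ Finset.range (m + 1), ENNReal.ofReal b :=
        Finset.sum_le_sum fun j hj => iSup_enorm_le fun x hx =>
          h x hx j (Nat.lt_succ_iff.1 (Finset.mem_range.1 hj))
    _ = ENNReal.ofReal ((m + 1) * b) := by
        rw [Finset.sum_const, Finset.card_range, nsmul_eq_mul, ENNReal.ofReal_mul (by positivity)]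
        congr 1
        rw [← Nat.cast_succ, ENNReal.ofReal_natCast]

lemma tendsto_zero_of_le_ofReal {F : ℕ → ℝ≥0∞}
    (h : ∀ η : ℝ, 0 < η → ∀ᶠ k in atTop, F k ≤ ENNReal.ofReal η) : Tendsto F atTop (𝓝 0) := by
  refine ENNReal.tendsto_nhds_zero.2 fun e he => ?_
  obtain ⟨r, hr0, hr⟩ := ENNReal.lt_iff_exists_nnreal_btwn.1 he
  filter_upwards [h r (by exact_mod_cast hr0)] with k hk
  refine hk.trans ?_
  rw [ENNReal.ofReal_coe_nnreal]
  exact hr.le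

/-! ### Lipschitz estimates for the error -/

/-- The equation for the error bounds `νE'` by `O(ν^α + ν)`, which is `O(ν^α)` because `α ≤ 1`.
Staying `ε` away from `±1` gives `1-z² ≥ ε²`. -/
lemma exists_error_lipschitz (c : ℝ × ℝ × ℝ) {ε : ℝ} (hε : 0 < ε) :
    ∃ C > 0, ∀ᶠ d in admFilter c, ∀ x ∈ Ioo (d.left + ε) (1 - ε),
      ∀ y ∈ Ioo (d.left + ε) (1 - ε),
      |(d.sol x ^ 2 / 2 - P d.par x) - (d.sol y ^ 2 / 2 - P d.par y)| ≤
        C * d.nu ^ alpha c * (|x - y| / d.nu) := by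
  obtain ⟨C, hC, h⟩ := exists_error_le c hε
  set B := bound c + 1 with hB
  have hB1 : 1 ≤ B := by linarith [bound_nonneg c]
  refine ⟨(8 * B * C + 2 * (8 * B) ^ 2 + B) / ε ^ 2, by positivity, ?_⟩
  filter_upwards [h, eventually_admissible c, eventually_nu_lt c one_pos, eventually_bound_le c]
    with d h1 hd hν1 hb x hx y hy
  have hν := hd.nu_pos
  have hα : d.nu ≤ d.nu ^ alpha c := by
    have := Real.rpow_le_rpow_of_exponent_ge hν hν1.le (alpha_le_one c)
    rwa [Real.rpow_one] at this
  have hα0 : 0 < d.nu ^ alpha c := Real.rpow_pos_of_pos hν _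
  have hder : ∀ z ∈ Ioo (d.left + ε) (1 - ε),
      ‖-(d.sol z * (d.sol z ^ 2 / 2 - P d.par z) + 2 * d.nu * z * d.sol z ^ 2 +
        d.nu * (1 - z ^ 2) * dP d.par z) / (d.nu * (1 - z ^ 2))‖ ≤
      (8 * B * C + 2 * (8 * B) ^ 2 + B) / ε ^ 2 * d.nu ^ alpha c / d.nu := by
    intro z hz
    have hzI := hd.mem (mem_Ioo_left hε hz)
    obtain ⟨⟨h2, h3⟩, h4⟩ := h1 z ⟨hz.1, by linarith [hz.2]⟩
    have ha := one_sub_sq_pos hzI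
    have haε : ε ^ 2 ≤ 1 - z ^ 2 := by
      have h5 : ε ≤ 1 - z := by linarith [hz.2]
      have h6 : ε ≤ 1 + z := by linarith [hz.1, hd.left_ge]
      nlinarith
    have hdP := (abs_dP_le d.par (Ioo_subset_Icc_self hzI)).trans hb
    have e1 : |d.sol z * (d.sol z ^ 2 / 2 - P d.par z)| ≤ 8 * B * (C * d.nu ^ alpha c) := by
      rw [abs_mul, abs_of_pos h2]
      gcongr
    have e2 : |2 * d.nu * z * d.sol z ^ 2| ≤ 2 * d.nu ^ alpha c * 1 * (8 * B) ^ 2 := by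
      rw [abs_mul, abs_mul, abs_of_pos (show 0 < 2 * d.nu by positivity),
        abs_of_nonneg (sq_nonneg (d.sol z))]
      gcongr
      exact abs_le.2 ⟨hzI.1.le, hzI.2.le⟩
    have e3 : |d.nu * (1 - z ^ 2) * dP d.par z| ≤ d.nu ^ alpha c * 1 * B := by
      rw [abs_mul, abs_mul, abs_of_pos hν, abs_of_pos ha]
      gcongr
      nlinarith [sq_nonneg z]
    have e4 := abs_add_three (d.sol z * (d.sol z ^ 2 / 2 - P d.par z))
      (2 * d.nu * z * d.sol z ^ 2) (d.nu * (1 - z ^ 2) * dP d.par z)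
    rw [Real.norm_eq_abs, abs_div, abs_neg, abs_of_pos (mul_pos hν ha),
      div_le_iff₀ (mul_pos hν ha)]
    have e5 : (8 * B * C + 2 * (8 * B) ^ 2 + B) / ε ^ 2 * d.nu ^ alpha c / d.nu *
        (d.nu * ε ^ 2) = (8 * B * C + 2 * (8 * B) ^ 2 + B) * d.nu ^ alpha c := by
      field_simp
    have e6 : (8 * B * C + 2 * (8 * B) ^ 2 + B) / ε ^ 2 * d.nu ^ alpha c / d.nu *
        (d.nu * ε ^ 2) ≤ (8 * B * C + 2 * (8 * B) ^ 2 + B) / ε ^ 2 * d.nu ^ alpha c / d.nu *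
        (d.nu * (1 - z ^ 2)) := by gcongr
    linarith
  have := (convex_Ioo (d.left + ε) (1 - ε)).norm_image_sub_le_of_norm_hasDerivWithin_le
    (f := fun t => d.sol t ^ 2 / 2 - P d.par t)
    (fun z hz => (hd.solution.hasDerivAt_error hν
      (hd.mem (mem_Ioo_left hε hz))).hasDerivWithinAt) hder hy hx
  rw [Real.norm_eq_abs, Real.norm_eq_abs] at this
  refine this.trans (le_of_eq ?_)
  ring

/-- Interpolation between the sup bound and the Lipschitz bound, used with `t = |x-y|/ν`. -/
lemma min_one_le_rpow {t β : ℝ} (ht : 0 ≤ t) (hβ : 0 ≤ β) (hβ1 : β ≤ 1) : min 1 t ≤ t ^ β := by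
  rcases le_total t 1 with h | h
  · exact (min_le_right _ _).trans (Real.self_le_rpow_of_le_one ht h hβ1)
  · exact (min_le_left _ _).trans (Real.one_le_rpow h hβ)

lemma reflect_error (c : ℝ × ℝ × ℝ) (U : ℝ → ℝ) (t : ℝ) :
    reflFun U (-t) ^ 2 / 2 - P (refl c) (-t) = U t ^ 2 / 2 - P c t := by
  simp [reflFun, P_refl]

lemma profile_refl (c : ℝ × ℝ × ℝ) (t : ℝ) : profile (refl c) t = profile c (-t) := by
  rw [profile, profile, P_refl]

/-! ### Consequences for sequences -/

lemma isClosed_J0 : IsClosed J0 := by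
  have h1 : IsClosed {c : ℝ × ℝ × ℝ | 0 ≤ c.1} := isClosed_le (by fun_prop) (by fun_prop)
  have h2 : IsClosed {c : ℝ × ℝ × ℝ | 0 ≤ c.2.1} := isClosed_le (by fun_prop) (by fun_prop)
  have h3 : IsClosed {c : ℝ × ℝ × ℝ | c3star c.1 c.2.1 ≤ c.2.2} := by
    unfold c3star
    exact isClosed_le (by fun_prop) (by fun_prop)
  exact h1.inter (h2.inter h3)

section Sequences

variable {ν : ℕ → ℝ} {cs : ℕ → ℝ × ℝ × ℝ} {U : ℕ → ℝ → ℝ} {x : ℕ → ℝ}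

lemma IsViscositySequence.mem_J0 (h : IsViscositySequence c ν cs U) : c ∈ J0 :=
  isClosed_J0.mem_of_tendsto h.c_tendsto (Eventually.of_forall h.c_mem)

/-- The left end point is the zero itself, to the right of which the solution is positive. -/
lemma IsViscositySequence.tendsto_datum (h : IsViscositySequence c ν cs U) (hc : c ≠ 0)
    (hx : IsZeroSequence U x) :
    Tendsto (fun k => Datum.mk (ν k) (cs k) (U k) (x k)) atTop (admFilter c) := by
  refine tendsto_admFilter h.nu_tendsto h.c_tendsto ?_
  filter_upwards [hx, h.c_tendsto.eventually_ne hc] with k hk hck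
  exact ⟨h.nu_pos k, h.c_mem k, h.solution k, hk.1.1.le, fun y hy =>
    (h.solution k).pos_of_zero (h.nu_pos k) (h.c_mem k) hck hk.1 hk.2 hy.1 hy.2⟩

lemma IsViscositySequence.tendsto_datum_of_pos (h : IsViscositySequence c ν cs U)
    (hU : ∀ᶠ k in atTop, ∀ y ∈ Ioo (-1 : ℝ) 1, 0 < U k y) :
    Tendsto (fun k => Datum.mk (ν k) (cs k) (U k) (-1)) atTop (admFilter c) := by
  refine tendsto_admFilter h.nu_tendsto h.c_tendsto ?_
  filter_upwards [hU] with k hk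
  exact ⟨h.nu_pos k, h.c_mem k, h.solution k, le_rfl, hk⟩

lemma IsViscositySequence.eventually_fst_pos (h : IsViscositySequence c ν cs U) (h1 : 0 < c.1) :
    ∀ᶠ k in atTop, 0 < (cs k).1 :=
  ((continuous_fst.tendsto c).comp h.c_tendsto).eventually_const_lt h1

lemma IsViscositySequence.eventually_snd_pos (h : IsViscositySequence c ν cs U) (h2 : 0 < c.2.1) :
    ∀ᶠ k in atTop, 0 < (cs k).2.1 :=
  (((continuous_fst.comp continuous_snd).tendsto c).comp h.c_tendsto).eventually_const_lt h2

/-- A zero-free solution has constant sign, so it would be the upper or the lower solution. -/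
lemma IsViscositySequence.exists_zero (h : IsViscositySequence c ν cs U) (h1 : 0 < c.1)
    (h2 : 0 < c.2.1) : ∀ᶠ k in atTop, ∃ x ∈ Ioo (-1 : ℝ) 1, U k x = 0 := by
  filter_upwards [h.eventually_fst_pos h1, h.eventually_snd_pos h2] with k hk1 hk2
  by_contra! hne
  rcases (h.solution k).pos_or_neg hne with hp | hn
  · exact h.not_upper k ((h.solution k).isUpperSolution_of_pos (h.nu_pos k) (h.c_mem k) hk1 hp)
  · exact h.not_lower k ((h.solution k).isLowerSolution_of_neg (h.nu_pos k) (h.c_mem k) hk2 hn)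

end Sequences

/-! ### Convergence to the limit profile, up to the end point in the degenerate case. -/

lemma abs_sub_le_sqrt {a b : ℝ} (ha : 0 ≤ a) (hb : 0 ≤ b) : |a - b| ≤ √|a ^ 2 - b ^ 2| := by
  refine Real.abs_le_sqrt ?_
  have e : a ^ 2 - b ^ 2 = (a - b) * (a + b) := by ring
  rw [e, abs_mul, abs_of_nonneg (show 0 ≤ a + b by linarith), ← sq_abs, sq]
  gcongr
  exact abs_le.2 ⟨by linarith, by linarith⟩

/-- Uniform convergence to the limit profile to the right of the zero. -/
lemma eventually_sub_profile_le (hc : c ∈ J0) {ε η : ℝ} (hε : 0 < ε) (hη : 0 < η) :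
    ∀ᶠ d in admFilter c, ∀ x ∈ Ioo (d.left + ε) 1, |d.sol x - profile c x| ≤ η := by
  obtain ⟨C, hC, h⟩ := exists_error_le c hε
  have h1 : Tendsto (fun d : Datum => √(2 * (C * d.nu ^ alpha c)) +
      √(2 * bound (d.par - c))) (admFilter c) (𝓝 0) := by
    have e1 : Tendsto (fun d : Datum => C * d.nu ^ alpha c) (admFilter c)
        (𝓝 (C * 0 ^ alpha c)) :=
      ((tendsto_nu c).rpow_const (Or.inr (alpha_pos c).le)).const_mul C
    rw [Real.zero_rpow (alpha_pos c).ne', mul_zero] at e1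
    have e2 := (tendsto_bound_sub c).comp (tendsto_par c)
    simpa using ((e1.const_mul 2).sqrt).add ((e2.const_mul 2).sqrt)
  filter_upwards [h, h1.eventually_lt_const hη, eventually_admissible c] with d h2 h3 hd x hx
  have hxI : x ∈ Icc (-1 : ℝ) 1 :=
    Ioo_subset_Icc_self (hd.mem ⟨by linarith [hx.1], hx.2⟩)
  obtain ⟨⟨h4, _⟩, h5⟩ := h2 x hx
  have hq' := profile_sq (P_nonneg hd.par_mem hxI)
  have hq := profile_sq (P_nonneg hc hxI)
  -- Comparing squares costs half an order, but it needs no lower bound on `P`, which may vanish.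
  have e1 : |d.sol x - profile d.par x| ≤ √(2 * (C * d.nu ^ alpha c)) := by
    refine (abs_sub_le_sqrt h4.le (profile_nonneg _ _)).trans (Real.sqrt_le_sqrt ?_)
    have : d.sol x ^ 2 - profile d.par x ^ 2 = 2 * (d.sol x ^ 2 / 2 - P d.par x) := by
      rw [hq']; ring
    rw [this, abs_mul, abs_two]
    gcongr
  have e2 : |profile d.par x - profile c x| ≤ √(2 * bound (d.par - c)) := by
    refine (abs_sub_le_sqrt (profile_nonneg _ _) (profile_nonneg _ _)).trans
      (Real.sqrt_le_sqrt ?_)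
    rw [hq', hq, ← mul_sub, abs_mul, abs_two, P_sub]
    gcongr
    exact abs_P_le _ hxI
  have := abs_sub_le (d.sol x) (profile d.par x) (profile c x)
  linarith

/-- If `c₁ = 0`, the convergence to the limit profile holds up to the left end point. -/
lemma eventually_sub_profile_le_of_fst_eq_zero (hc : c ∈ J0) (h1 : c.1 = 0) {η : ℝ}
    (hη : 0 < η) : ∃ ε > 0, ∀ᶠ d in admFilter c, d.left < -1 + ε →
      (-1 < d.left → d.sol d.left = 0) → ∀ x ∈ Ioo (-1 : ℝ) 1, |d.sol x - profile c x| ≤ η := by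
  have hP0 : P c (-1) = 0 := by simp [P, h1]
  have hcont : ∀ᶠ x in 𝓝 (-1 : ℝ), P c x < (η / 2) ^ 2 / 16 :=
    ((continuous_P c).tendsto (-1)).eventually_lt_const (by rw [hP0]; positivity)
  obtain ⟨r, hr, hrP⟩ := Metric.eventually_nhds_iff.1 hcont
  -- Points not covered by the previous lemma satisfy `x ≤ left + ε < -1 + 2ε`, and `P_c` is small
  -- up to `-1 + 2ε`.
  set ε := min (r / 4) (1 / 4) with hεd
  have hε : 0 < ε := by positivity
  refine ⟨ε, hε, ?_⟩
  filter_upwards [eventually_sub_profile_le hc hε hη, eventually_admissible c,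
    eventually_nu_lt c (show 0 < η / 16 by positivity),
    ((tendsto_bound_sub c).comp (tendsto_par c)).eventually_lt_const
      (show 0 < (η / 2) ^ 2 / 16 by positivity)] with d h2 hd hν hb hleft hz x hx
  have hε1 : ε ≤ 1 / 4 := min_le_right _ _
  rcases lt_or_ge (d.left + ε) x with hlt | hge
  · exact h2 x ⟨hlt, hx.2⟩
  have hsmall : ∀ y ∈ Icc (-1 : ℝ) (-1 + 2 * ε), P c y < (η / 2) ^ 2 / 16 := fun y hy => by
    refine hrP ?_
    have : ε ≤ r / 4 := min_le_left _ _
    rw [Real.dist_eq, abs_of_nonneg (by linarith [hy.1])]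
    linarith [hy.2]
  have hsmall' : ∀ y ∈ Icc (-1 : ℝ) (-1 + 2 * ε), 8 * P d.par y ≤ (η / 2) ^ 2 := fun y hy => by
    have e1 := (abs_le.1 (abs_P_le (d.par - c) (x := y) ⟨hy.1, by linarith [hy.2]⟩)).2
    rw [← P_sub] at e1
    have e2 := hsmall y hy
    have e3 : bound (d.par - c) < (η / 2) ^ 2 / 16 := hb
    linarith
  have hup : d.sol x ≤ η / 2 := hd.solution.le_of_barrier hd.nu_pos hx (by linarith)
    fun y hy => hsmall' y ⟨hy.1.le, by linarith [hy.2]⟩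
  have hlo : -(η / 2) ≤ d.sol x := by
    rcases lt_or_ge d.left x with hlx | hlx
    · linarith [hd.pos x ⟨hlx, hx.2⟩]
    · have hl1 : -1 < d.left := hx.1.trans_le hlx
      -- To the left of the zero, the reflected solution starts from the value `0` and stays below
      -- the barrier.
      have := hd.solution.reflect.le_of_left_le hd.nu_pos (a := -d.left) (b := -x) (M := η / 2)
        (by linarith) (by linarith) (by linarith [hx.1]) (by linarith)
        (fun y hy => by
          rw [P_refl]
          exact hsmall' (-y) ⟨by linarith [hy.2, hx.1], by linarith [hy.1]⟩)
        (by simp [reflFun, hz hl1]; positivity)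
      simp only [reflFun, neg_neg] at this
      linarith
  have hq0 := profile_nonneg c x
  have hq1 : profile c x ≤ η / 2 := by
    refine Real.sqrt_le_iff.2 ⟨by positivity, ?_⟩
    have := hsmall x ⟨hx.1.le, by linarith⟩
    nlinarith [sq_nonneg η]
  exact abs_le.2 ⟨by linarith, by linarith⟩

/-- From an interior point one can decrease each coordinate a little without leaving `J0`, so each
defining inequality is strict. -/
lemma pos_of_mem_interior (h : c ∈ interior J0) :
    0 < c.1 ∧ 0 < c.2.1 ∧ c3star c.1 c.2.1 < c.2.2 := by
  have hd : ∀ v : ℝ × ℝ × ℝ, ∃ t > 0, c - (t : ℝ) • v ∈ J0 := fun v => by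
    have : Tendsto (fun t : ℝ => c - t • v) (𝓝[>] 0) (𝓝 (c - (0 : ℝ) • v)) := by
      refine Tendsto.mono_left (Continuous.tendsto (by fun_prop) _) nhdsWithin_le_nhds
    rw [zero_smul, sub_zero] at this
    obtain ⟨t, ht1, ht2⟩ := ((this.eventually (mem_interior_iff_mem_nhds.1 h)).and
      self_mem_nhdsWithin).exists
    exact ⟨t, ht2, ht1⟩
  obtain ⟨t, ht, h1, -, -⟩ := hd (1, 0, 0)
  obtain ⟨t', ht', -, h2, -⟩ := hd (0, 1, 0)
  obtain ⟨t'', ht'', -, -, h3⟩ := hd (0, 0, 1)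
  simp at h1 h2 h3
  exact ⟨by linarith, by linarith, by linarith⟩

section Sequences

variable {ν : ℕ → ℝ} {cs : ℕ → ℝ × ℝ × ℝ} {U : ℕ → ℝ → ℝ} {x : ℕ → ℝ}

lemma IsViscositySequence.tendsto_profile (h : IsViscositySequence c ν cs U) (hc : c ≠ 0)
    (hx : IsZeroSequence U x) {ε : ℝ} (hε : 0 < ε) :
    Tendsto (fun k => linftyNorm (Ioo (-1) (x k - ε)) (fun t => U k t + profile c t) +
      linftyNorm (Ioo (x k + ε) 1) (fun t => U k t - profile c t)) atTop (𝓝 0) := by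
  refine tendsto_zero_of_le_ofReal fun η hη => ?_
  have hr := (h.tendsto_datum hc hx).eventually
    (eventually_sub_profile_le h.mem_J0 hε (half_pos hη))
  have hl := (h.reflect.tendsto_datum (refl_ne_zero hc) hx.reflect).eventually
    (eventually_sub_profile_le h.reflect.mem_J0 hε (half_pos hη))
  filter_upwards [hr, hl] with k h1 h2
  calc _ ≤ ENNReal.ofReal (η / 2) + ENNReal.ofReal (η / 2) := by
        refine add_le_add (linftyNorm_le measurableSet_Ioo fun t ht => ?_)
          (linftyNorm_le measurableSet_Ioo h1)
        have := h2 (-t) ⟨by linarith [ht.2], by linarith [ht.1]⟩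
        simp only [reflFun, neg_neg, profile_refl] at this
        rw [← abs_neg]
        convert this using 2
        ring
    _ = ENNReal.ofReal η := by
        rw [← ENNReal.ofReal_add (by positivity) (by positivity), add_halves]

end Sequences

/-! ### Sup and Hölder rates on both sides of the zero. -/

lemma exists_error_norm_le {ε : ℝ} (hc : c ≠ 0) (hε : 0 < ε) {β : ℝ≥0} (hβ : (β : ℝ) < alpha c) :
    ∃ C : ℝ, 0 < C ∧ ∀ (ν : ℕ → ℝ) (cs : ℕ → ℝ × ℝ × ℝ) (U : ℕ → ℝ → ℝ) (x : ℕ → ℝ),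
      IsViscositySequence c ν cs U → IsZeroSequence U x → ∀ᶠ k in atTop,
        linftyNorm (Ioo (-1) (x k - ε) ∪ Ioo (x k + ε) 1)
          (fun t => U k t ^ 2 / 2 - P (cs k) t) +
        ENNReal.ofReal (ν k ^ (β : ℝ)) *
          holderNorm β (Ioo (-1 + ε) (x k - ε) ∪ Ioo (x k + ε) (1 - ε))
            (fun t => U k t ^ 2 / 2 - P (cs k) t)
        ≤ ENNReal.ofReal (C * ν k ^ alpha c) := by
  obtain ⟨C₁, hC₁, H₁⟩ := exists_error_le c hε
  obtain ⟨C₂, hC₂, H₂⟩ := exists_error_le (refl c) hε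
  obtain ⟨C₃, hC₃, H₃⟩ := exists_error_lipschitz c hε
  obtain ⟨C₄, hC₄, H₄⟩ := exists_error_lipschitz (refl c) hε
  rw [alpha_refl] at H₂ H₄
  -- The factor `2` allows for a difference of two errors. In `3 * C` below, one `C` is for the
  -- `L^∞` norm and two for the sup and the seminorm in the Hölder norm.
  set C := 2 * (C₁ + C₂) + C₃ + C₄ with hC
  have hC0 : 0 < C := by positivity
  refine ⟨3 * C, by positivity, fun ν cs U x h hx => ?_⟩
  have hr := h.tendsto_datum hc hx
  have hl := h.reflect.tendsto_datum (refl_ne_zero hc) hx.reflect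
  filter_upwards [hr.eventually H₁, hl.eventually H₂, hr.eventually H₃, hl.eventually H₄,
    h.nu_tendsto.eventually_lt_const one_pos, h.nu_tendsto.eventually_lt_const hε]
    with k k1 k2 k3 k4 hν1 hνε
  have hν := h.nu_pos k
  set A := ν k ^ alpha c with hA
  have hA0 : 0 < A := Real.rpow_pos_of_pos hν _
  have hsup : ∀ t ∈ Ioo (-1) (x k - ε) ∪ Ioo (x k + ε) 1,
      |U k t ^ 2 / 2 - P (cs k) t| ≤ (C₁ + C₂) * A := by
    rintro t (ht | ht)
    · have := (k2 (-t) ⟨by linarith [ht.2], by linarith [ht.1]⟩).2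
      rw [reflect_error] at this
      exact this.trans (by gcongr; linarith)
    · exact (k1 t ht).2.trans (by gcongr; linarith)
  have hsub : Ioo (-1 + ε) (x k - ε) ∪ Ioo (x k + ε) (1 - ε) ⊆
      Ioo (-1) (x k - ε) ∪ Ioo (x k + ε) 1 :=
    union_subset_union (Ioo_subset_Ioo_left (by linarith)) (Ioo_subset_Ioo_right (by linarith))
  have hle : (C₁ + C₂) * A ≤ C * A := by
    have : C₁ + C₂ ≤ C := by linarith
    gcongr
  have hmin : ∀ t ∈ Ioo (-1 + ε) (x k - ε) ∪ Ioo (x k + ε) (1 - ε),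
      ∀ s ∈ Ioo (-1 + ε) (x k - ε) ∪ Ioo (x k + ε) (1 - ε),
      |(U k t ^ 2 / 2 - P (cs k) t) - (U k s ^ 2 / 2 - P (cs k) s)| ≤
        C * A * min 1 (|t - s| / ν k) := by
    intro t ht s hs
    have hCA : 0 ≤ C * A := by positivity
    have hone : |(U k t ^ 2 / 2 - P (cs k) t) - (U k s ^ 2 / 2 - P (cs k) s)| ≤ C * A * 1 := by
      have h1 := hsup t (hsub ht)
      have h2 := hsup s (hsub hs)
      have h3 := abs_sub (U k t ^ 2 / 2 - P (cs k) t) (U k s ^ 2 / 2 - P (cs k) s)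
      have h4 : 2 * ((C₁ + C₂) * A) ≤ C * A := by
        rw [← mul_assoc]; gcongr; linarith
      linarith
    -- Across the layer no Lipschitz bound is available, but points on different sides are more than
    -- `ε > ν` apart, so the sup bound suffices.
    have hfar : ε ≤ |t - s| →
        |(U k t ^ 2 / 2 - P (cs k) t) - (U k s ^ 2 / 2 - P (cs k) s)| ≤
          C * A * (|t - s| / ν k) := fun hts => hone.trans (by
      gcongr
      rw [one_le_div hν]
      linarith)
    rw [mul_min_of_nonneg _ _ hCA]
    refine le_min hone ?_
    rcases ht with ht | ht <;> rcases hs with hs | hs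
    · have := k4 (-t) ⟨by linarith [ht.2], by linarith [ht.1]⟩ (-s)
        ⟨by linarith [hs.2], by linarith [hs.1]⟩
      rw [reflect_error, reflect_error, show -t - -s = -(t - s) by ring, abs_neg] at this
      refine this.trans ?_
      gcongr
      linarith
    · refine hfar ?_
      rw [abs_sub_comm]
      exact le_trans (by linarith [ht.2, hs.1]) (le_abs_self _)
    · exact hfar (le_trans (by linarith [hs.2, ht.1]) (le_abs_self _))
    · refine (k3 t ht s hs).trans ?_
      gcongr
      linarith
  have hβ1 : (β : ℝ) ≤ 1 := hβ.le.trans (alpha_le_one c)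
  have hνβ : 0 < ν k ^ (β : ℝ) := Real.rpow_pos_of_pos hν _
  have hνβ1 : ν k ^ (β : ℝ) ≤ 1 := Real.rpow_le_one hν.le hν1.le β.coe_nonneg
  have hhol := holderNorm_le (β := β) (L := C * A / ν k ^ (β : ℝ)) (b := C * A) (by positivity)
    (fun t ht => (hsup t (hsub ht)).trans hle) (fun t ht s hs => (hmin t ht s hs).trans (by
      have h1 := min_one_le_rpow (t := |t - s| / ν k) (by positivity) β.coe_nonneg hβ1
      rw [Real.div_rpow (abs_nonneg _) hν.le] at h1
      calc C * A * min 1 (|t - s| / ν k) ≤ C * A * (|t - s| ^ (β : ℝ) / ν k ^ (β : ℝ)) := by gcongr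
        _ = _ := by ring))
  calc _ ≤ ENNReal.ofReal (C * A) + ENNReal.ofReal (ν k ^ (β : ℝ)) *
        (ENNReal.ofReal (C * A) + ENNReal.ofReal (C * A / ν k ^ (β : ℝ))) :=
        add_le_add (linftyNorm_le (measurableSet_Ioo.union measurableSet_Ioo)
          fun t ht => (hsup t ht).trans hle) (by gcongr)
    _ = ENNReal.ofReal (C * A + ν k ^ (β : ℝ) * (C * A + C * A / ν k ^ (β : ℝ))) := by
        rw [← ENNReal.ofReal_add (by positivity) (by positivity),
          ← ENNReal.ofReal_mul hνβ.le, ← ENNReal.ofReal_add (by positivity) (by positivity)]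
    _ ≤ ENNReal.ofReal (3 * C * A) := by
        refine ENNReal.ofReal_le_ofReal ?_
        have e : ν k ^ (β : ℝ) * (C * A + C * A / ν k ^ (β : ℝ)) =
            ν k ^ (β : ℝ) * (C * A) + C * A := by field_simp
        have : ν k ^ (β : ℝ) * (C * A) ≤ 1 * (C * A) := by gcongr
        rw [e]
        linarith

section Sequences

variable {ν : ℕ → ℝ} {cs : ℕ → ℝ × ℝ × ℝ} {U : ℕ → ℝ → ℝ} {x : ℕ → ℝ}

lemma IsViscositySequence.tendsto_of_zero_tendsto (h : IsViscositySequence c ν cs U) (hc : c ≠ 0)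
    (h1 : c.1 = 0) (hx : IsZeroSequence U x) (hx1 : Tendsto x atTop (𝓝 (-1))) :
    Tendsto (fun k => linftyNorm (Ioo (-1) 1) (fun t => U k t - profile c t)) atTop (𝓝 0) := by
  refine tendsto_zero_of_le_ofReal fun η hη => ?_
  obtain ⟨ε, hε, H⟩ := eventually_sub_profile_le_of_fst_eq_zero h.mem_J0 h1 hη
  filter_upwards [(h.tendsto_datum hc hx).eventually H, hx,
    hx1.eventually_lt_const (show (-1 : ℝ) < -1 + ε by linarith)] with k k1 k2 k3
  exact linftyNorm_le measurableSet_Ioo (k1 k3 fun _ => k2.2)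

lemma IsViscositySequence.tendsto_of_pos (h : IsViscositySequence c ν cs U)
    (h1 : c.1 = 0) (hU : ∀ᶠ k in atTop, ∀ y ∈ Ioo (-1 : ℝ) 1, 0 < U k y) :
    Tendsto (fun k => linftyNorm (Ioo (-1) 1) (fun t => U k t - profile c t)) atTop (𝓝 0) := by
  refine tendsto_zero_of_le_ofReal fun η hη => ?_
  obtain ⟨ε, hε, H⟩ := eventually_sub_profile_le_of_fst_eq_zero h.mem_J0 h1 hη
  filter_upwards [(h.tendsto_datum_of_pos hU).eventually H] with k k1
  exact linftyNorm_le measurableSet_Ioo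
    (k1 (by linarith) fun h => absurd h (lt_irrefl _))

/-- The first alternative of the convergence on all of `(-1, 1)`. -/
lemma IsViscositySequence.tendsto_upper (h : IsViscositySequence c ν cs U) (hc : c ≠ 0)
    (hcase : (c.1 = 0 ∧ ∃ x : ℕ → ℝ, IsZeroSequence U x ∧ Tendsto x atTop (𝓝 (-1))) ∨
      (c.1 = 0 ∧ 0 < c.2.1 ∧ IsZeroFree U)) :
    Tendsto (fun k => linftyNorm (Ioo (-1) 1) (fun t => U k t - profile c t)) atTop (𝓝 0) := by
  rcases hcase with ⟨h1, x, hx, hx1⟩ | ⟨h1, h2, hU⟩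
  · exact h.tendsto_of_zero_tendsto hc h1 hx hx1
  · refine h.tendsto_of_pos h1 ?_
    filter_upwards [hU, h.eventually_snd_pos h2] with k hk hk2
    rcases (h.solution k).pos_or_neg hk with hp | hn
    · exact hp
    · exact absurd ((h.solution k).isLowerSolution_of_neg (h.nu_pos k) (h.c_mem k) hk2 hn)
        (h.not_lower k)

/-- Convergence of the reflected sequence translates back. -/
lemma tendsto_of_reflect
    (h : Tendsto (fun k => linftyNorm (Ioo (-1) 1)
      (fun t => reflFun (U k) t - profile (refl c) t)) atTop (𝓝 0)) :
    Tendsto (fun k => linftyNorm (Ioo (-1) 1) (fun t => U k t + profile c t)) atTop (𝓝 0) := by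
  refine h.congr fun k => ?_
  have hmp : MeasurePreserving (fun t : ℝ => -t) (volume.restrict (Ioo (-1) 1))
      (volume.restrict (Ioo (-1) 1)) := by
    have := (Measure.measurePreserving_neg (volume : Measure ℝ)).restrict_preimage_emb
      (Homeomorph.neg ℝ).measurableEmbedding (Ioo (-1) 1)
    simpa using this
  have e : (fun t => reflFun (U k) t - profile (refl c) t) =
      -((fun t => U k t + profile c t) ∘ fun t => -t) := by
    ext t
    simp only [reflFun, profile_refl, Pi.neg_apply, Function.comp_apply]
    ring
  have hmap := (Homeomorph.neg ℝ).measurableEmbedding.eLpNorm_map_measure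
    (g := fun t => U k t + profile c t) (p := ∞) (μ := volume.restrict (Ioo (-1) 1))
  rw [linftyNorm, e, eLpNorm_neg, linftyNorm]
  refine hmap.symm.trans ?_
  congr 1
  exact hmp.map_eq

lemma IsViscositySequence.comp (h : IsViscositySequence c ν cs U) {φ : ℕ → ℕ}
    (hφ : StrictMono φ) :
    IsViscositySequence c (ν ∘ φ) (cs ∘ φ) (fun k => U (φ k)) where
  nu_pos _ := h.nu_pos _
  nu_tendsto := h.nu_tendsto.comp hφ.tendsto_atTop
  c_mem _ := h.c_mem _
  c_tendsto := h.c_tendsto.comp hφ.tendsto_atTop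
  solution _ := h.solution _
  not_upper _ := h.not_upper _
  not_lower _ := h.not_lower _

end Sequences

/-- The third alternative: without zeros and with `c₁ = c₂ = 0`, one of the two limits is attained
along a subsequence. -/
lemma IsViscositySequence.exists_subseq {ν : ℕ → ℝ} {cs : ℕ → ℝ × ℝ × ℝ} {U : ℕ → ℝ → ℝ}
    (h : IsViscositySequence c ν cs U) (h1 : c.1 = 0) (h2 : c.2.1 = 0) (hU : IsZeroFree U) :
    ∃ φ : ℕ → ℕ, StrictMono φ ∧
      (Tendsto (fun k => linftyNorm (Ioo (-1) 1) (fun t => U (φ k) t - profile c t)) atTop (𝓝 0) ∨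
      Tendsto (fun k => linftyNorm (Ioo (-1) 1) (fun t => U (φ k) t + profile c t))
        atTop (𝓝 0)) := by
  -- Either infinitely many `U k` are positive and these form the subsequence, or all late ones are
  -- negative and the whole sequence works after reflection.
  by_cases hp : ∃ᶠ k in atTop, ∀ y ∈ Ioo (-1 : ℝ) 1, 0 < U k y
  · obtain ⟨φ, hφ, hφU⟩ := extraction_of_frequently_atTop hp
    exact ⟨φ, hφ, Or.inl ((h.comp hφ).tendsto_of_pos h1 (Eventually.of_forall hφU))⟩
  · refine ⟨id, strictMono_id, Or.inr (tendsto_of_reflect (h.reflect.tendsto_of_pos h2 ?_))⟩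
    filter_upwards [hU, not_frequently.1 hp] with k hk hk' y hy
    exact neg_pos.2 (((h.solution k).pos_or_neg hk).resolve_left hk' (-y) (neg_mem_Ioo_one hy))

/-- This form, a composition with negation, lets iterated derivatives to the left of the zero be
read off from the reflected solution. -/
lemma reflect_add_profile (c : ℝ × ℝ × ℝ) (U : ℝ → ℝ) :
    (fun t => U t + profile c t) =
      fun t => -(fun s => reflFun U s - profile (refl c) s) (-t) := by
  ext t
  simp only [reflFun, profile_refl, neg_neg]
  ring

/-- The estimates of order `ν` when `P_c` is positive on `[-1, 1]`. -/
lemma exists_cmNorm_le (hc : c ≠ 0) (hP : ∀ x ∈ Icc (-1 : ℝ) 1, 0 < P c x) {ε : ℝ} (hε : 0 < ε)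
    (m : ℕ) :
    ∃ C : ℝ, 0 < C ∧ ∀ (ν : ℕ → ℝ) (cs : ℕ → ℝ × ℝ × ℝ) (U : ℕ → ℝ → ℝ) (x : ℕ → ℝ),
      IsViscositySequence c ν cs U → IsZeroSequence U x → ∀ᶠ k in atTop,
        linftyNorm (Ioo (-1) (x k - ε)) (fun t => U k t + profile (cs k) t) +
          linftyNorm (Ioo (x k + ε) 1) (fun t => U k t - profile (cs k) t)
          ≤ ENNReal.ofReal (C * ν k) ∧
        cmNorm m (Ioo (-1 + ε) (x k - ε)) (fun t => U k t + profile (cs k) t) +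
          cmNorm m (Ioo (x k + ε) (1 - ε)) (fun t => U k t - profile (cs k) t)
          ≤ ENNReal.ofReal (C * ν k) := by
  have hP' : ∀ x ∈ Icc (-1 : ℝ) 1, 0 < P (refl c) x := fun x hx => by
    rw [P_refl]
    exact hP (-x) ⟨by linarith [hx.2], by linarith [hx.1]⟩
  obtain ⟨C₁, hC₁, H₁⟩ := exists_sub_profile_le hP hε
  obtain ⟨C₂, hC₂, H₂⟩ := exists_sub_profile_le hP' hε
  obtain ⟨C₃, hC₃, H₃⟩ := exists_iteratedDeriv_sub_profile_le hP hε m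
  obtain ⟨C₄, hC₄, H₄⟩ := exists_iteratedDeriv_sub_profile_le hP' hε m
  refine ⟨C₁ + C₂ + (m + 1) * (C₃ + C₄), by positivity, fun ν cs U x h hx => ?_⟩
  have hr := h.tendsto_datum hc hx
  have hl := h.reflect.tendsto_datum (refl_ne_zero hc) hx.reflect
  filter_upwards [hr.eventually H₁, hl.eventually H₂, hr.eventually H₃, hl.eventually H₄]
    with k k1 k2 k3 k4
  have hν := h.nu_pos k
  rw [reflect_add_profile]
  constructor
  · calc _ ≤ ENNReal.ofReal (C₂ * ν k) + ENNReal.ofReal (C₁ * ν k) := by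
          refine add_le_add (linftyNorm_le measurableSet_Ioo fun t ht => ?_)
            (linftyNorm_le measurableSet_Ioo k1)
          rw [abs_neg]
          exact k2 (-t) ⟨by linarith [ht.2], by linarith [ht.1]⟩
      _ = ENNReal.ofReal (C₂ * ν k + C₁ * ν k) := by
          rw [← ENNReal.ofReal_add (by positivity) (by positivity)]
      _ ≤ _ := by
          refine ENNReal.ofReal_le_ofReal ?_
          have : 0 ≤ (m + 1) * (C₃ + C₄) * ν k := by positivity
          linarith
  · calc _ ≤ ENNReal.ofReal ((m + 1) * (C₄ * ν k)) + ENNReal.ofReal ((m + 1) * (C₃ * ν k)) := by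
          refine add_le_add (cmNorm_le ?_ fun t ht j hj => ?_)
            (cmNorm_le (k3.1.mono (Ioo_subset_Ioo (by linarith) (by linarith))) k3.2)
          · exact (k4.1.comp contDiff_neg.contDiffOn fun t ht =>
              ⟨by linarith [ht.2], by linarith [ht.1]⟩).neg
          · have e := iteratedDeriv_comp_neg j
              (fun s => reflFun (U k) s - profile (refl (cs k)) s) t
            rw [iteratedDeriv_fun_neg, e, abs_neg, smul_eq_mul, abs_mul,
              abs_pow, abs_neg, abs_one, one_pow, one_mul]
            exact k4.2 (-t) ⟨by linarith [ht.2], by linarith [ht.1]⟩ j hj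
      _ = ENNReal.ofReal ((m + 1) * (C₄ * ν k) + (m + 1) * (C₃ * ν k)) := by
          rw [← ENNReal.ofReal_add (by positivity) (by positivity)]
      _ ≤ _ := by
          refine ENNReal.ofReal_le_ofReal ?_
          have : 0 ≤ (C₁ + C₂) * ν k := by positivity
          linarith

end ReducedNS

end

theorem theorem1p8 (c : ℝ × ℝ × ℝ) (hc : c ≠ 0) :
    -- at most one zero, and existence of a zero for large `k` if `c₁, c₂ > 0`
    (∀ (ν : ℕ → ℝ) (cs : ℕ → ℝ × ℝ × ℝ) (U : ℕ → ℝ → ℝ),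
      ReducedNS.IsViscositySequence c ν cs U →
        (∀ k, cs k ≠ 0 → ∀ x ∈ Ioo (-1 : ℝ) 1, ∀ y ∈ Ioo (-1 : ℝ) 1,
          U k x = 0 → U k y = 0 → x = y) ∧
        (0 < c.1 → 0 < c.2.1 → ∀ᶠ k in atTop, ∃ x ∈ Ioo (-1 : ℝ) 1, U k x = 0)) ∧
    -- (i), convergence away from the zeros
    (∀ (ν : ℕ → ℝ) (cs : ℕ → ℝ × ℝ × ℝ) (U : ℕ → ℝ → ℝ) (x : ℕ → ℝ),
      ReducedNS.IsViscositySequence c ν cs U → ReducedNS.IsZeroSequence U x →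
        ∀ ε : ℝ, 0 < ε →
          Tendsto (fun k =>
            ReducedNS.linftyNorm (Ioo (-1) (x k - ε))
              (fun t => U k t + √(2 * ReducedNS.P c t)) +
            ReducedNS.linftyNorm (Ioo (x k + ε) 1)
              (fun t => U k t - √(2 * ReducedNS.P c t))) atTop (𝓝 0)) ∧
    -- (i), rate of convergence, with a constant depending only on `c`, `ε`, `β`
    (∀ ε : ℝ, 0 < ε → ∀ β : ℝ≥0, 0 < β → (β : ℝ) < ReducedNS.alpha c →
      ∃ C : ℝ, 0 < C ∧
        ∀ (ν : ℕ → ℝ) (cs : ℕ → ℝ × ℝ × ℝ) (U : ℕ → ℝ → ℝ) (x : ℕ → ℝ),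
          ReducedNS.IsViscositySequence c ν cs U → ReducedNS.IsZeroSequence U x →
            ∀ᶠ k in atTop,
              ReducedNS.linftyNorm (Ioo (-1) (x k - ε) ∪ Ioo (x k + ε) 1)
                (fun t => U k t ^ 2 / 2 - ReducedNS.P (cs k) t) +
              ENNReal.ofReal (ν k ^ (β : ℝ)) *
                ReducedNS.holderNorm β
                  (Ioo (-1 + ε) (x k - ε) ∪ Ioo (x k + ε) (1 - ε))
                  (fun t => U k t ^ 2 / 2 - ReducedNS.P (cs k) t)
              ≤ ENNReal.ofReal (C * ν k ^ ReducedNS.alpha c)) ∧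
    -- (ii)
    (∀ (ν : ℕ → ℝ) (cs : ℕ → ℝ × ℝ × ℝ) (U : ℕ → ℝ → ℝ),
      ReducedNS.IsViscositySequence c ν cs U →
        (((c.1 = 0 ∧ ∃ x : ℕ → ℝ, ReducedNS.IsZeroSequence U x ∧ Tendsto x atTop (𝓝 (-1))) ∨
            (c.1 = 0 ∧ 0 < c.2.1 ∧ ReducedNS.IsZeroFree U)) →
          Tendsto (fun k => ReducedNS.linftyNorm (Ioo (-1) 1)
            (fun t => U k t - √(2 * ReducedNS.P c t))) atTop (𝓝 0)) ∧
        (((c.2.1 = 0 ∧ ∃ x : ℕ → ℝ, ReducedNS.IsZeroSequence U x ∧ Tendsto x atTop (𝓝 1)) ∨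
            (c.2.1 = 0 ∧ 0 < c.1 ∧ ReducedNS.IsZeroFree U)) →
          Tendsto (fun k => ReducedNS.linftyNorm (Ioo (-1) 1)
            (fun t => U k t + √(2 * ReducedNS.P c t))) atTop (𝓝 0)) ∧
        (c.1 = 0 → c.2.1 = 0 → ReducedNS.IsZeroFree U →
          ∃ φ : ℕ → ℕ, StrictMono φ ∧
            (Tendsto (fun k => ReducedNS.linftyNorm (Ioo (-1) 1)
              (fun t => U (φ k) t - √(2 * ReducedNS.P c t))) atTop (𝓝 0) ∨
            Tendsto (fun k => ReducedNS.linftyNorm (Ioo (-1) 1)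
              (fun t => U (φ k) t + √(2 * ReducedNS.P c t))) atTop (𝓝 0)))) ∧
    -- (iii), with a constant depending only on `c`, `ε`, `m`
    (c ∈ interior ReducedNS.J0 →
      (∀ (ν : ℕ → ℝ) (cs : ℕ → ℝ × ℝ × ℝ) (U : ℕ → ℝ → ℝ),
        ReducedNS.IsViscositySequence c ν cs U →
          ∀ᶠ k in atTop, ∃ x ∈ Ioo (-1 : ℝ) 1, U k x = 0) ∧
      (∀ ε : ℝ, 0 < ε → ∀ m : ℕ, 0 < m →
        ∃ C : ℝ, 0 < C ∧
          ∀ (ν : ℕ → ℝ) (cs : ℕ → ℝ × ℝ × ℝ) (U : ℕ → ℝ → ℝ) (x : ℕ → ℝ),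
            ReducedNS.IsViscositySequence c ν cs U → ReducedNS.IsZeroSequence U x →
              ∀ᶠ k in atTop,
                ReducedNS.linftyNorm (Ioo (-1) (x k - ε))
                    (fun t => U k t + √(2 * ReducedNS.P (cs k) t)) +
                  ReducedNS.linftyNorm (Ioo (x k + ε) 1)
                    (fun t => U k t - √(2 * ReducedNS.P (cs k) t))
                  ≤ ENNReal.ofReal (C * ν k) ∧
                ReducedNS.cmNorm m (Ioo (-1 + ε) (x k - ε))
                    (fun t => U k t + √(2 * ReducedNS.P (cs k) t)) +
                  ReducedNS.cmNorm m (Ioo (x k + ε) (1 - ε))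
                    (fun t => U k t - √(2 * ReducedNS.P (cs k) t))
                  ≤ ENNReal.ofReal (C * ν k))) := by
  refine ⟨fun ν cs U h => ⟨fun k hk x hx y hy hUx hUy =>
      (h.solution k).zero_unique (h.nu_pos k) (h.c_mem k) hk hx hy hUx hUy,
      h.exists_zero⟩,
    fun ν cs U x h hx ε hε => h.tendsto_profile hc hx hε,
    fun ε hε β _ hβ => ReducedNS.exists_error_norm_le hc hε hβ,
    fun ν cs U h => ⟨h.tendsto_upper hc, fun hcase => ?_, h.exists_subseq⟩,
    fun hint => ?_⟩
  -- The case `c₂ = 0` is the case `c₁ = 0` for the reflected sequence, whose zeros are `-x k`.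
  · refine ReducedNS.tendsto_of_reflect (h.reflect.tendsto_upper (ReducedNS.refl_ne_zero hc) ?_)
    rcases hcase with ⟨h2, x, hx, hx1⟩ | ⟨h2, h1, hU⟩
    · exact Or.inl ⟨h2, fun k => -x k, hx.reflect, hx1.neg⟩
    · exact Or.inr ⟨h2, h1, hU.reflect⟩
  · have hpos := ReducedNS.pos_of_mem_interior hint
    exact ⟨fun ν cs U h => h.exists_zero hpos.1 hpos.2.1, fun ε hε m _ =>
      ReducedNS.exists_cmNorm_le hc (ReducedNS.P_pos_of_alpha_eq_one hpos) hε m⟩
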